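/- Let $G$ be a connected (finite-dimensional, real, smooth) Lie group with finite centre and Lie algebra $\mathfrak{g}$, and let $K \subset G$ be a connected compact (hence closed) subgroup with Lie algebra $\mathfrak{k} = \{X \in \mathfrak{g} : \exp(tX) \in K \text{ for all } t \in \mathbb{R}\}$. Let $\theta : \mathfrak{g} \to \mathfrak{g}$ be a Lie algebra automorphism with $\theta^2 = \mathrm{id}$ whose $(+1)$-eigenspace is $\mathfrak{k}$, i.e. $\mathfrak{k} = \{X \in \mathfrak{g} : \theta(X) = X\}$, and put $\mathfrak{p} = \{X \in \mathfrak{g} : \theta(X) = -X\}$, so that $\mathfrak{g} = \mathfrak{k} \oplus \mathfrak{p}$. Then $G = KP$, where $P = \exp(\mathfrak{p})$; that is, every $g \in G$ can be written as $g = k\exp(X)$ with $k \in K$ and $X \in \mathfrak{p}$. -/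

import Mathlib

open scoped Manifold ContDiff Pointwise

namespace LieKP

instance leInfty_minSmoothness_three : ENat.LEInfty (minSmoothness ℝ 3) := by
  rw [minSmoothness_of_isRCLikeNormedField]
  infer_instance

section Exp

variable {E : Type*} [NormedAddCommGroup E] [NormedSpace ℝ E]
  {G : Type*} [TopologicalSpace G] [ChartedSpace E G] [Group G]
  [LieGroup 𝓘(ℝ, E) ∞ G]

theorem contMDiff_invariantField (X : GroupLieAlgebra 𝓘(ℝ, E) G) :
    ContMDiff 𝓘(ℝ, E) 𝓘(ℝ, E).tangent 1
      (fun g : G => (⟨g, mulInvariantVectorField X g⟩ : TangentBundle 𝓘(ℝ, E) G)) := by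
  refine (contMDiff_mulInvariantVectorField X).of_le ?_
  rw [minSmoothness_of_isRCLikeNormedField]
  exact one_le_two

theorem mfderiv_mul_invariantField (X : GroupLieAlgebra 𝓘(ℝ, E) G) (g h : G) :
    mfderiv 𝓘(ℝ, E) 𝓘(ℝ, E) (fun x : G => g * x) h (mulInvariantVectorField X h) =
      mulInvariantVectorField X (g * h) := by
  have hd : ∀ a b : G, MDifferentiableAt 𝓘(ℝ, E) 𝓘(ℝ, E) (fun x : G => a * x) b := fun a b =>
    (contMDiff_mul_left (I := 𝓘(ℝ, E)) (n := ∞) (a := a)).mdifferentiableAt (by simp)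
  have hc : (fun x : G => g * h * x) = (fun x : G => g * x) ∘ (fun x : G => h * x) := by
    ext x; simp [mul_assoc]
  simp only [mulInvariantVectorField]
  rw [hc, mfderiv_comp_of_eq (I' := 𝓘(ℝ, E)) (x := (1 : G)) (y := h) (hd g h) (hd h 1)
    (mul_one h)]
  have e : (mfderiv 𝓘(ℝ, E) 𝓘(ℝ, E) (fun x : G => g * x) (h * 1) : E →L[ℝ] E) =
      mfderiv 𝓘(ℝ, E) 𝓘(ℝ, E) (fun x : G => g * x) h := by
    rw [mul_one]
  exact (congrArg (fun L : E →L[ℝ] E =>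
    L (mfderiv 𝓘(ℝ, E) 𝓘(ℝ, E) (fun x : G => h * x) 1 X)) e).symm

/-- Left translates of integral curves of a left-invariant field are integral curves of it. -/
theorem integralCurveOn_mul_left (X : GroupLieAlgebra 𝓘(ℝ, E) G) (g : G) {γ : ℝ → G} {s : Set ℝ}
    (hγ : IsMIntegralCurveOn γ (mulInvariantVectorField (I := 𝓘(ℝ, E)) X) s) :
    IsMIntegralCurveOn (fun t => g * γ t) (mulInvariantVectorField (I := 𝓘(ℝ, E)) X) s := by
  intro t ht
  have hd : HasMFDerivAt 𝓘(ℝ, E) 𝓘(ℝ, E) (fun x : G => g * x) (γ t) _ :=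
    ((contMDiff_mul_left (I := 𝓘(ℝ, E)) (n := ∞) (a := g)).mdifferentiableAt
      (by simp)).hasMFDerivAt
  have h := hd.comp_hasMFDerivWithinAt t (hγ t ht)
  have e : ∀ (L : E →L[ℝ] E) (v : E), L.comp ((1 : ℝ →L[ℝ] ℝ).smulRight v) =
      (1 : ℝ →L[ℝ] ℝ).smulRight (L v) := by
    intro L v
    ext
    simp
  have h2 := (e (mfderiv 𝓘(ℝ, E) 𝓘(ℝ, E) (fun x : G => g * x) (γ t))
    (mulInvariantVectorField X (γ t))).trans
      (congrArg (fun v : E => (1 : ℝ →L[ℝ] ℝ).smulRight v)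
        (mfderiv_mul_invariantField X g (γ t)))
  exact HasMFDerivWithinAt.congr_mfderiv h h2

variable [CompleteSpace E]

/-- Left-invariant vector fields are complete. -/
theorem exists_integralCurve [T2Space G] (X : GroupLieAlgebra 𝓘(ℝ, E) G) :
    ∃ γ : ℝ → G, γ 0 = 1 ∧
      IsMIntegralCurve γ (mulInvariantVectorField (I := 𝓘(ℝ, E)) X) := by
  have : IsManifold 𝓘(ℝ, E) 1 G := IsManifold.of_le (n := ∞) (by simp)
  obtain ⟨γ, h0, hγ⟩ := exists_isMIntegralCurveAt_of_contMDiffAt_boundaryless (I := 𝓘(ℝ, E)) 0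
    (contMDiff_invariantField X).contMDiffAt (x₀ := (1 : G))
  obtain ⟨ε, hε, hγ⟩ := isMIntegralCurveAt_iff'.1 hγ
  rw [Real.ball_eq_Ioo, zero_sub, zero_add] at hγ
  exact exists_isMIntegralCurve_of_isMIntegralCurveOn (contMDiff_invariantField X) hε
    (fun g => ⟨fun t => g * γ t, by simp [h0], integralCurveOn_mul_left X g hγ⟩) 1

/-- The exponential map of a Lie group: `lieExp X = γ 1`, where `γ` is the (unique, globally
defined) integral curve with `γ 0 = 1` of the left-invariant vector field with value `X` at the
identity. -/
noncomputable def lieExp [T2Space G] (X : GroupLieAlgebra 𝓘(ℝ, E) G) : G :=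
  (exists_integralCurve X).choose 1

/-- `lieExp` does not depend on the choice of integral curve made in its definition. -/
theorem lieExp_eq [T2Space G] (X : GroupLieAlgebra 𝓘(ℝ, E) G) {γ : ℝ → G} (h0 : γ 0 = 1)
    (hγ : IsMIntegralCurve γ (mulInvariantVectorField (I := 𝓘(ℝ, E)) X)) :
    lieExp X = γ 1 := by
  have : IsManifold 𝓘(ℝ, E) 1 G := IsManifold.of_le (n := ∞) (by simp)
  have h := (exists_integralCurve X).choose_spec
  have := isMIntegralCurve_Ioo_eq_of_contMDiff_boundaryless (t₀ := 0)
    (contMDiff_invariantField X) h.2 hγ (h.1.trans h0.symm)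
  exact congrFun this 1

/-- The Lie algebra of a closed subgroup `K`, as a subset of the Lie algebra of `G`:
all `X` whose one-parameter subgroup `t ↦ exp (t X)` stays in `K`. -/
def subgroupLieAlgebra [T2Space G] (K : Subgroup G) : Set (GroupLieAlgebra 𝓘(ℝ, E) G) :=
  {X | ∀ t : ℝ, lieExp (t • X) ∈ K}

/-- The `(+1)`-eigenspace of a Lie algebra automorphism. -/
def fixedPart (θ : GroupLieAlgebra 𝓘(ℝ, E) G ≃ₗ⁅ℝ⁆ GroupLieAlgebra 𝓘(ℝ, E) G) :
    Set (GroupLieAlgebra 𝓘(ℝ, E) G) :=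
  {X | θ X = X}

/-- The `(-1)`-eigenspace of a Lie algebra automorphism. -/
def antiFixedPart (θ : GroupLieAlgebra 𝓘(ℝ, E) G ≃ₗ⁅ℝ⁆ GroupLieAlgebra 𝓘(ℝ, E) G) :
    Set (GroupLieAlgebra 𝓘(ℝ, E) G) :=
  {X | θ X = -X}

end Exp

end LieKP

/-! The statement is a Hopf–Rinow theorem for the symmetric space `G/K`: any point can be joined to
the base point by a geodesic, and the geodesics through the base point are the curves `exp (tX) K`
with `X ∈ 𝔭`. The proof is a direct shortening argument on the group, without Riemannian geometry.
It gives `G = exp 𝔭 · K`, and inversion exchanges the factors.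

Average an inner product over the compact group to get an invariant form `B` on the Lie algebra.
Call a list `X₁, …, Xₙ` in `𝔭` with `exp X₁ ⋯ exp Xₙ ∈ gK` a broken geodesic to `gK`, with energy `∑
B Xᵢ Xᵢ`. One exists because `exp 𝔭` and `K` generate the connected group `G` (`exists_isBroken`).
Cutting every side into `n` equal pieces divides the energy by `n`, so all sides may be assumed
short, and for a fixed number of sides an energy minimiser exists by compactness (`exists_minimal`).
If two neighbouring sides of the minimiser were different, say `X ≠ Y`, write `exp X exp Y = exp Z ·
k`, replace them by `Z/2, Z/2`, and push `k` to the right through the remaining sides by `Ad k`,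
which preserves `B`. This lowers the energy as soon as `B Z Z < 2 (B X X + B Y Y)`. Hence all sides
equal one `Y`, and their product is `exp (nY)`.

The inequality for short sides is the heart of the matter (`exists_corner_cutting`). Applying `Ad`
to `exp X exp Y = exp Z · k` and then conjugating by `θ` eliminates `k` and leaves `exp (ad X) exp
(2 ad Y) exp (ad X) = exp (2 ad Z)`. Put `W = Z - 2X` and `V = Y - X`. To first order `W = V`, with
error `O(δ ‖V‖)` for sides of length at most `δ`. This alone is too weak for the cross term `B X W`,
but `B X [X, ·]_𝔭 = 0`, which is the Gauss lemma here, and it improves the error in `B X W = B X V`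
to `O(δ ‖V‖²)`. Then `B Z Z - 2 (B X X + B Y Y) = 4 (B X W - B X V) + (B W W - B V V) - B V V` is
negative for small `δ`. Estimates on `ad W` give estimates on `W` because the finite centre makes
`ad` injective.

What remains is Lie theory done in the chart at the identity: continuity of `exp`, its derivative at
`0`, `Ad (exp X) = exp (ad X)`, and the identification of `ad` with the given Lie bracket. -/

namespace LieKP

open Filter Topology

set_option linter.unusedSectionVars false

/-! ### Multiplication and the adjoint representation in the chart at the identity. -/

section Chart

variable {E : Type*} [NormedAddCommGroup E] [NormedSpace ℝ E]
  (G : Type*) [TopologicalSpace G] [ChartedSpace E G] [Group G]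

/-- The preferred chart at the identity. -/
noncomputable def chartOne : PartialEquiv G E := extChartAt 𝓘(ℝ, E) (1 : G)

/-- The group multiplication in the chart at the identity. -/
noncomputable def chartMul (p : E × E) : E :=
  chartOne G ((chartOne G).symm p.1 * (chartOne G).symm p.2)

/-- Conjugation in the chart at the identity. -/
noncomputable def chartConj (p : E × E) : E :=
  chartOne G ((chartOne G).symm p.1 * (chartOne G).symm p.2 * ((chartOne G).symm p.1)⁻¹)

variable (E) in
/-- The coordinate of the identity. -/
noncomputable def cOne : E := chartOne G (1 : G)

/-- The differential of left translation at the identity, in the chart at the identity. -/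
noncomputable def leftD (x : E) : E →L[ℝ] E := fderiv ℝ (fun y => chartMul G (x, y)) (cOne E G)

/-- The differential of right translation at the identity, in the chart at the identity. -/
noncomputable def rightD (x : E) : E →L[ℝ] E := fderiv ℝ (fun y => chartMul G (y, x)) (cOne E G)

variable {G}

/-- The adjoint representation, in the chart at the identity. -/
noncomputable def Ad (g : G) : E →L[ℝ] E :=
  fderiv ℝ (fun y => chartOne G (g * (chartOne G).symm y * g⁻¹)) (cOne E G)

@[simp] theorem chartOne_symm_cOne : (chartOne G).symm (cOne E G) = 1 :=
  extChartAt_to_inv (I := 𝓘(ℝ, E)) (1 : G)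

@[simp] theorem chartOne_one : chartOne G 1 = cOne E G := rfl

theorem mem_chartOne_source : (1 : G) ∈ (chartOne (E := E) G).source := mem_extChartAt_source _

theorem chartOne_symm_left_inv_eventually :
    ∀ᶠ g in 𝓝 (1 : G), (chartOne (E := E) G).symm (chartOne G g) = g := by
  filter_upwards [extChartAt_source_mem_nhds (I := 𝓘(ℝ, E)) (1 : G)] with g hg
  exact (chartOne (E := E) G).left_inv hg

theorem chartOne_right_inv_eventually :
    ∀ᶠ y in 𝓝 (cOne E G), chartOne G ((chartOne G).symm y) = y := by
  filter_upwards [extChartAt_target_mem_nhds (I := 𝓘(ℝ, E)) (1 : G)] with y hy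
  exact (chartOne (E := E) G).right_inv hy

theorem continuousAt_chartOne : ContinuousAt (chartOne (E := E) G) 1 :=
  continuousAt_extChartAt (I := 𝓘(ℝ, E)) (1 : G)

@[simp] theorem Ad_one : Ad (E := E) (1 : G) = 1 := by
  refine HasFDerivAt.fderiv ((hasFDerivAt_id _).congr_of_eventuallyEq ?_)
  filter_upwards [chartOne_right_inv_eventually (E := E) (G := G)] with y hy
  simp [hy]

@[simp] theorem leftD_cOne : leftD G (cOne E G) = 1 := by
  refine HasFDerivAt.fderiv ((hasFDerivAt_id _).congr_of_eventuallyEq ?_)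
  filter_upwards [chartOne_right_inv_eventually (E := E) (G := G)] with y hy
  simp [chartMul, hy]

@[simp] theorem rightD_cOne : rightD G (cOne E G) = 1 := by
  refine HasFDerivAt.fderiv ((hasFDerivAt_id _).congr_of_eventuallyEq ?_)
  filter_upwards [chartOne_right_inv_eventually (E := E) (G := G)] with y hy
  simp [chartMul, hy]

variable [LieGroup 𝓘(ℝ, E) ∞ G]

theorem contMDiffAt_chartOne_symm :
    ContMDiffAt 𝓘(ℝ, E) 𝓘(ℝ, E) ∞ (chartOne G).symm (cOne E G) :=
  (contMDiffOn_extChartAt_symm (1 : G)).contMDiffAt (extChartAt_target_mem_nhds (1 : G))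

theorem contMDiffAt_chartOne {g : G} (hg : g ∈ (chartOne (E := E) G).source) :
    ContMDiffAt 𝓘(ℝ, E) 𝓘(ℝ, E) ∞ (chartOne (E := E) G) g :=
  contMDiffAt_extChartAt' (by simpa [chartOne] using hg)

theorem contDiffAt_chartMul : ContDiffAt ℝ ∞ (chartMul (E := E) G) (cOne E G, cOne E G) := by
  rw [← contMDiffAt_iff_contDiffAt]
  have h1 : ContMDiffAt 𝓘(ℝ, E × E) 𝓘(ℝ, E) ∞ (fun p : E × E => (chartOne G).symm p.1)
      (cOne E G, cOne E G) :=
    ContMDiffAt.comp (I' := 𝓘(ℝ, E)) (cOne E G, cOne E G)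
      contMDiffAt_chartOne_symm contDiff_fst.contMDiff.contMDiffAt
  have h2 : ContMDiffAt 𝓘(ℝ, E × E) 𝓘(ℝ, E) ∞ (fun p : E × E => (chartOne G).symm p.2)
      (cOne E G, cOne E G) :=
    ContMDiffAt.comp (I' := 𝓘(ℝ, E)) (cOne E G, cOne E G)
      contMDiffAt_chartOne_symm contDiff_snd.contMDiff.contMDiffAt
  refine ContMDiffAt.comp (I' := 𝓘(ℝ, E)) _ (contMDiffAt_chartOne ?_) (h1.mul h2)
  simp [mem_chartOne_source]

theorem contDiffAt_chartConj : ContDiffAt ℝ ∞ (chartConj (E := E) G) (cOne E G, cOne E G) := by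
  rw [← contMDiffAt_iff_contDiffAt]
  have h1 : ContMDiffAt 𝓘(ℝ, E × E) 𝓘(ℝ, E) ∞ (fun p : E × E => (chartOne G).symm p.1)
      (cOne E G, cOne E G) :=
    ContMDiffAt.comp (I' := 𝓘(ℝ, E)) (cOne E G, cOne E G)
      contMDiffAt_chartOne_symm contDiff_fst.contMDiff.contMDiffAt
  have h2 : ContMDiffAt 𝓘(ℝ, E × E) 𝓘(ℝ, E) ∞ (fun p : E × E => (chartOne G).symm p.2)
      (cOne E G, cOne E G) :=
    ContMDiffAt.comp (I' := 𝓘(ℝ, E)) (cOne E G, cOne E G)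
      contMDiffAt_chartOne_symm contDiff_snd.contMDiff.contMDiffAt
  refine ContMDiffAt.comp (I' := 𝓘(ℝ, E)) _ (contMDiffAt_chartOne ?_) ((h1.mul h2).mul h1.inv)
  simp [mem_chartOne_source]

theorem contDiffAt_leftD : ContDiffAt ℝ ∞ (leftD (E := E) G) (cOne E G) :=
  ContDiffAt.fderiv (m := ∞) (n := ∞) (f := fun x y => chartMul G (x, y)) (g := fun _ => cOne E G)
    (by exact contDiffAt_chartMul) contDiffAt_const (by simp)

theorem contDiffAt_rightD : ContDiffAt ℝ ∞ (rightD (E := E) G) (cOne E G) :=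
  ContDiffAt.fderiv (m := ∞) (n := ∞) (f := fun x y => chartMul G (y, x)) (g := fun _ => cOne E G)
    (contDiffAt_chartMul.comp (cOne E G, cOne E G) (contDiff_snd.prodMk contDiff_fst).contDiffAt) contDiffAt_const (by simp)

theorem contDiffAt_Ad_chart :
    ContDiffAt ℝ ∞ (fun x : E => Ad (E := E) ((chartOne G).symm x)) (cOne E G) :=
  ContDiffAt.fderiv (m := ∞) (n := ∞) (f := fun x y => chartConj G (x, y)) (g := fun _ => cOne E G)
    (by exact contDiffAt_chartConj) contDiffAt_const (by simp)

theorem differentiableAt_chart_comp {f : G → G} (hf : ContMDiffAt 𝓘(ℝ, E) 𝓘(ℝ, E) ∞ f 1)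
    (h1 : f (1 : G) ∈ (chartOne (E := E) G).source) :
    DifferentiableAt ℝ (fun y : E => chartOne (E := E) G (f ((chartOne G).symm y))) (cOne E G) := by
  have : ContMDiffAt 𝓘(ℝ, E) 𝓘(ℝ, E) ∞ (fun y : E => chartOne (E := E) G (f ((chartOne G).symm y)))
      (cOne E G) := by
    refine ContMDiffAt.comp (I' := 𝓘(ℝ, E)) _ (contMDiffAt_chartOne ?_)
      (ContMDiffAt.comp (I' := 𝓘(ℝ, E)) _ ?_ contMDiffAt_chartOne_symm)
    · simpa using h1
    · simpa using hf
  exact (contMDiffAt_iff_contDiffAt.1 this).differentiableAt (by simp)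

theorem tendsto_chartOne_symm : Tendsto (chartOne G).symm (𝓝 (cOne E G)) (𝓝 (1 : G)) := by
  simpa using (contMDiffAt_chartOne_symm (E := E) (G := G)).continuousAt.tendsto

theorem contMDiff_conj (g : G) : ContMDiff 𝓘(ℝ, E) 𝓘(ℝ, E) ∞ (fun x : G => g * x * g⁻¹) :=
  (contMDiff_const.mul contMDiff_id).mul contMDiff_const

theorem hasFDerivAt_conj_chart (g : G) :
    HasFDerivAt (fun y => chartOne G (g * (chartOne G).symm y * g⁻¹)) (Ad (E := E) g)
      (cOne E G) :=
  (differentiableAt_chart_comp (contMDiff_conj g).contMDiffAt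
    (by simp [mem_chartOne_source])).hasFDerivAt

theorem Ad_mul (g h : G) : Ad (E := E) (g * h) = (Ad g).comp (Ad h) := by
  have h2 := hasFDerivAt_conj_chart (E := E) h
  have h1 : HasFDerivAt (fun y => chartOne G (g * (chartOne G).symm y * g⁻¹)) (Ad (E := E) g)
      (chartOne G (h * (chartOne G).symm (cOne E G) * h⁻¹)) := by
    simpa using hasFDerivAt_conj_chart (E := E) g
  refine HasFDerivAt.fderiv ((HasFDerivAt.comp (cOne E G)
    (f := fun y => chartOne G (h * (chartOne G).symm y * h⁻¹)) h1 h2).congr_of_eventuallyEq ?_)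
  have hc : Tendsto (fun y => h * (chartOne G).symm y * h⁻¹) (𝓝 (cOne E G)) (𝓝 1) := by
    have := ((contMDiff_conj (E := E) h).continuous.tendsto 1).comp
      (tendsto_chartOne_symm (E := E) (G := G))
    simpa [Function.comp_def] using this
  filter_upwards [hc.eventually (chartOne_symm_left_inv_eventually (E := E))] with y hy
  simp only [Function.comp]
  rw [hy]
  simp [mul_assoc]

theorem continuousAt_Ad_one : ContinuousAt (fun g : G => Ad (E := E) g) 1 := by
  have h := ContinuousAt.comp (x := (1 : G)) (f := chartOne (E := E) G)
    (contDiffAt_Ad_chart (E := E) (G := G)).continuousAt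
    (continuousAt_chartOne (E := E) (G := G))
  refine h.congr ?_
  filter_upwards [chartOne_symm_left_inv_eventually (E := E) (G := G)] with g hg
  simp only [Function.comp]
  rw [hg]

/-- `Ad` is multiplicative, so continuity at the identity spreads to all of `G`. -/
theorem continuous_Ad : Continuous (fun g : G => Ad (E := E) g) := by
  have : IsTopologicalGroup G := topologicalGroup_of_lieGroup 𝓘(ℝ, E) ∞
  rw [continuous_iff_continuousAt]
  intro g
  have h1 : ContinuousAt (fun h : G => g⁻¹ * h) g := (continuous_const_mul g⁻¹).continuousAt
  have h2 : ContinuousAt (fun h : G => Ad (E := E) (g⁻¹ * h)) g :=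
    ContinuousAt.comp (f := fun h : G => g⁻¹ * h) (g := fun h : G => Ad (E := E) h)
      (by simpa using continuousAt_Ad_one) h1
  have h3 : ContinuousAt (fun h : G => (Ad (E := E) g).comp (Ad (E := E) (g⁻¹ * h))) g :=
    (ContinuousLinearMap.compL ℝ E E E (Ad g)).continuous.continuousAt.comp h2
  refine h3.congr (Eventually.of_forall fun h => ?_)
  simp [← Ad_mul]

/-- Left translation by `x` is conjugation by `x` followed by right translation by `x`.
Differentiating this at the identity of the chart is what links `Ad` to the second derivative of the
multiplication. -/
theorem leftD_eventuallyEq :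
    leftD (E := E) G =ᶠ[𝓝 (cOne E G)] fun x => (rightD G x).comp (Ad ((chartOne G).symm x)) := by
  have h1 : ∀ᶠ p in 𝓝 (cOne E G, cOne E G), DifferentiableAt ℝ (chartMul (E := E) G) p :=
    (((contDiffAt_chartMul (E := E) (G := G)).of_le (m := 1) (by simp)).eventually
      (by simp)).mono fun p hp => hp.differentiableAt (by simp)
  have h2 : Tendsto (fun x : E => (cOne E G, x)) (𝓝 (cOne E G)) (𝓝 (cOne E G, cOne E G)) :=
    (continuous_const.prodMk continuous_id).tendsto _
  filter_upwards [h2.eventually h1] with x hx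
  have hN := hasFDerivAt_conj_chart (E := E) ((chartOne G).symm x)
  have hM : HasFDerivAt (fun z => chartMul G (z, x)) (rightD G x)
      (chartOne G ((chartOne G).symm x * (chartOne G).symm (cOne E G) *
        ((chartOne G).symm x)⁻¹)) := by
    have : DifferentiableAt ℝ (fun z => chartMul G (z, x)) (cOne E G) :=
      DifferentiableAt.comp (cOne E G) (f := fun z : E => (z, x)) hx (by fun_prop)
    have h : HasFDerivAt (fun z => chartMul G (z, x)) (rightD G x) (cOne E G) := this.hasFDerivAt
    simpa using h
  refine HasFDerivAt.fderiv ((HasFDerivAt.comp (cOne E G)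
    (f := fun y => chartOne G ((chartOne G).symm x * (chartOne G).symm y *
      ((chartOne G).symm x)⁻¹)) hM hN).congr_of_eventuallyEq ?_)
  have hc : Tendsto (fun y => (chartOne G).symm x * (chartOne G).symm y * ((chartOne G).symm x)⁻¹)
      (𝓝 (cOne E G)) (𝓝 1) := by
    have := ((contMDiff_conj (E := E) ((chartOne G).symm x)).continuous.tendsto 1).comp
      (tendsto_chartOne_symm (E := E) (G := G))
    simpa [Function.comp_def] using this
  filter_upwards [hc.eventually (chartOne_symm_left_inv_eventually (E := E))] with y hy
  simp only [Function.comp, chartMul]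
  rw [hy]
  simp

/-- The structure tensor `ad` of the Lie algebra, read off the multiplication in the chart. -/
noncomputable def chartAd (G : Type*) [TopologicalSpace G] [ChartedSpace E G] [Group G] :
    E →L[ℝ] E →L[ℝ] E :=
  fderiv ℝ (leftD G) (cOne E G) - (fderiv ℝ (leftD G) (cOne E G)).flip

/-- Both sides are mixed second derivatives of the multiplication at the identity, so they agree by
symmetry of the second derivative. -/
theorem fderiv_rightD_apply (X Y : E) :
    fderiv ℝ (rightD G) (cOne E G) X Y = fderiv ℝ (leftD G) (cOne E G) Y X := by
  set M := chartMul (E := E) G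
  set c := cOne E G
  have hM : ContDiffAt ℝ ∞ M (c, c) := contDiffAt_chartMul
  have h1 : ∀ᶠ p in 𝓝 (c, c), DifferentiableAt ℝ M p :=
    ((hM.of_le (m := 1) (by simp)).eventually (by simp)).mono
      fun p hp => hp.differentiableAt (by simp)
  have h2 : (2 : WithTop ℕ∞) ≤ ∞ := ENat.LEInfty.out
  have hS : HasFDerivAt (fderiv ℝ M) (fderiv ℝ (fderiv ℝ M) (c, c)) (c, c) :=
    ((hM.fderiv_right (m := 1) (by rwa [one_add_one_eq_two])).differentiableAt (by simp)).hasFDerivAt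
  have hsymm : IsSymmSndFDerivAt ℝ M (c, c) := hM.isSymmSndFDerivAt (by simpa using h2)
  have hl : leftD G =ᶠ[𝓝 c] fun x => (fderiv ℝ M (x, c)).comp (.inr ℝ E E) := by
    have h2 : Tendsto (fun x : E => (x, c)) (𝓝 c) (𝓝 (c, c)) :=
      (continuous_id.prodMk continuous_const).tendsto _
    filter_upwards [h2.eventually h1] with x hx
    exact (HasFDerivAt.comp c (f := fun y => (x, y)) hx.hasFDerivAt
      (hasFDerivAt_prodMk_right x c)).fderiv
  have hr : rightD G =ᶠ[𝓝 c] fun x => (fderiv ℝ M (c, x)).comp (.inl ℝ E E) := by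
    have h2 : Tendsto (fun x : E => (c, x)) (𝓝 c) (𝓝 (c, c)) :=
      (continuous_const.prodMk continuous_id).tendsto _
    filter_upwards [h2.eventually h1] with x hx
    exact (HasFDerivAt.comp c (f := fun y => (y, x)) hx.hasFDerivAt
      (hasFDerivAt_prodMk_left c x)).fderiv
  have hl' : HasFDerivAt (leftD G) _ c :=
    (((HasFDerivAt.comp c (f := fun y => (y, c)) hS (hasFDerivAt_prodMk_left c c)).clm_comp
      (hasFDerivAt_const (ContinuousLinearMap.inr ℝ E E) c))).congr_of_eventuallyEq hl
  have hr' : HasFDerivAt (rightD G) _ c :=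
    (((HasFDerivAt.comp c (f := fun y => (c, y)) hS (hasFDerivAt_prodMk_right c c)).clm_comp
      (hasFDerivAt_const (ContinuousLinearMap.inl ℝ E E) c))).congr_of_eventuallyEq hr
  rw [hl'.fderiv, hr'.fderiv]
  simpa using hsymm (0, X) (Y, 0)

/-- The product rule applied to `leftD = rightD ∘ Ad` gives `D Ad = D leftD - D rightD`, and `D
rightD` is `D leftD` with its arguments exchanged. -/
theorem hasFDerivAt_Ad_chart :
    HasFDerivAt (fun x : E => Ad (E := E) ((chartOne G).symm x)) (chartAd G) (cOne E G) := by
  have ha := (contDiffAt_Ad_chart (E := E) (G := G)).differentiableAt (by simp) |>.hasFDerivAt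
  have hR := (contDiffAt_rightD (E := E) (G := G)).differentiableAt (by simp) |>.hasFDerivAt
  have hF := ((hR.clm_comp ha).congr_of_eventuallyEq leftD_eventuallyEq).fderiv
  have key : chartAd G = fderiv ℝ (fun x : E => Ad (E := E) ((chartOne G).symm x)) (cOne E G) := by
    ext X Y
    have := congrArg (fun L : E →L[ℝ] E →L[ℝ] E => L X Y) hF
    simp [fderiv_rightD_apply] at this
    simp [chartAd, this]
  rwa [key]

end Chart

end LieKP

namespace LieKP

open Filter Topology Set

set_option linter.unusedSectionVars false

/-! ### Logarithmic derivatives and one-parameter subgroups. -/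

section LogDeriv

variable {E : Type*} [NormedAddCommGroup E] [NormedSpace ℝ E]
  {G : Type*} [TopologicalSpace G] [ChartedSpace E G] [Group G]

/-- The curve `γ` has left logarithmic derivative `X` at time `t`. -/
def HasLogDerivAt (γ : ℝ → G) (X : E) (t : ℝ) : Prop :=
  ContinuousAt γ t ∧ HasDerivAt (fun s => chartOne (E := E) G ((γ t)⁻¹ * γ s)) X t

variable [LieGroup 𝓘(ℝ, E) ∞ G]

theorem mulInvariantVectorField_one (X : GroupLieAlgebra 𝓘(ℝ, E) G) :
    mulInvariantVectorField X (1 : G) = X := by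
  simp only [mulInvariantVectorField]
  have : (fun x : G => 1 * x) = id := by ext; simp
  rw [this, mfderiv_id]
  rfl

theorem hasMFDerivAt_iff_of_eq_one {δ : ℝ → G} {t : ℝ} (h : δ t = 1)
    (X : GroupLieAlgebra 𝓘(ℝ, E) G) :
    HasMFDerivAt 𝓘(ℝ, ℝ) 𝓘(ℝ, E) δ t
      ((1 : ℝ →L[ℝ] ℝ).smulRight (mulInvariantVectorField X (δ t))) ↔
    ContinuousAt δ t ∧ HasDerivAt (fun s => chartOne (E := E) G (δ s)) (X : E) t := by
  have key : ∀ g : G, g = 1 →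
      (HasFDerivWithinAt (extChartAt 𝓘(ℝ, E) g ∘ δ) ((1 : ℝ →L[ℝ] ℝ).smulRight
        (mulInvariantVectorField X g : E)) univ t ↔
      HasDerivAt (fun s => chartOne (E := E) G (δ s)) (X : E) t) := by
    rintro g rfl
    rw [mulInvariantVectorField_one, hasFDerivWithinAt_univ]
    rfl
  rw [← key _ h]
  simp only [HasMFDerivAt]
  refine and_congr_right fun _ => ?_
  rw [ModelWithCorners.range_eq_univ]
  rfl

theorem hasMFDerivAt_mul_left (X : GroupLieAlgebra 𝓘(ℝ, E) G) (g : G) {γ : ℝ → G} {t : ℝ}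
    (hγ : HasMFDerivAt 𝓘(ℝ, ℝ) 𝓘(ℝ, E) γ t
      ((1 : ℝ →L[ℝ] ℝ).smulRight (mulInvariantVectorField X (γ t)))) :
    HasMFDerivAt 𝓘(ℝ, ℝ) 𝓘(ℝ, E) (fun s => g * γ s) t
      ((1 : ℝ →L[ℝ] ℝ).smulRight (mulInvariantVectorField X (g * γ t))) := by
  have hd : HasMFDerivAt 𝓘(ℝ, E) 𝓘(ℝ, E) (fun x : G => g * x) (γ t) _ :=
    ((contMDiff_mul_left (I := 𝓘(ℝ, E)) (n := ∞) (a := g)).mdifferentiableAt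
      (by simp)).hasMFDerivAt
  have h := hd.comp t hγ
  have e : ∀ (L : E →L[ℝ] E) (v : E), L.comp ((1 : ℝ →L[ℝ] ℝ).smulRight v) =
      (1 : ℝ →L[ℝ] ℝ).smulRight (L v) := by
    intro L v
    ext
    simp
  have h2 := (e (mfderiv 𝓘(ℝ, E) 𝓘(ℝ, E) (fun x : G => g * x) (γ t))
    (mulInvariantVectorField X (γ t))).trans
      (congrArg (fun v : E => (1 : ℝ →L[ℝ] ℝ).smulRight v)
        (mfderiv_mul_invariantField X g (γ t)))
  exact HasMFDerivAt.congr_mfderiv h h2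

/-- Translating by `(γ t)⁻¹` moves the curve to the identity, where the invariant field has value
`X` and the preferred chart is the fixed one. Integral curves can thereby be handled with ordinary
derivatives in `E`. -/
theorem hasMFDerivAt_iff_hasLogDerivAt (X : GroupLieAlgebra 𝓘(ℝ, E) G) {γ : ℝ → G} {t : ℝ} :
    HasMFDerivAt 𝓘(ℝ, ℝ) 𝓘(ℝ, E) γ t
      ((1 : ℝ →L[ℝ] ℝ).smulRight (mulInvariantVectorField X (γ t))) ↔
    HasLogDerivAt (E := E) γ X t := by
  have : IsTopologicalGroup G := topologicalGroup_of_lieGroup 𝓘(ℝ, E) ∞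
  have h1 := hasMFDerivAt_iff_of_eq_one (δ := fun s => (γ t)⁻¹ * γ s) (t := t) (by simp) X
  constructor
  · intro h
    exact ⟨h.continuousAt, (h1.1 (hasMFDerivAt_mul_left X _ h)).2⟩
  · intro h
    have h2 := hasMFDerivAt_mul_left X (γ t) (h1.2 ⟨continuousAt_const.mul h.1, h.2⟩)
    have e : (fun s => γ t * ((γ t)⁻¹ * γ s)) = γ := by simp
    have key : ∀ γ' : ℝ → G, γ' = γ → HasMFDerivAt 𝓘(ℝ, ℝ) 𝓘(ℝ, E) γ' t
        ((1 : ℝ →L[ℝ] ℝ).smulRight (mulInvariantVectorField X (γ' t))) →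
        HasMFDerivAt 𝓘(ℝ, ℝ) 𝓘(ℝ, E) γ t
          ((1 : ℝ →L[ℝ] ℝ).smulRight (mulInvariantVectorField X (γ t))) := by
      rintro _ rfl h
      exact h
    exact key _ e h2

variable [CompleteSpace E] [T2Space G]

/-- The exponential map on the model space. -/
noncomputable def expE (X : E) : G := lieExp (G := G) (X : GroupLieAlgebra 𝓘(ℝ, E) G)

/-- By uniqueness of integral curves, a solution on an open interval around `[0, 1]` suffices; this
lets a local solution in the chart compute the exponential. -/
theorem expE_eq_of_hasLogDerivAt {X : E} {γ : ℝ → G} {a b : ℝ} (ha : a < 0) (hb : 1 < b)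
    (h0 : γ 0 = 1) (h : ∀ t ∈ Ioo a b, HasLogDerivAt γ X t) : expE X = γ 1 := by
  have : IsManifold 𝓘(ℝ, E) 1 G := IsManifold.of_le (n := ∞) (by simp)
  obtain ⟨δ, hδ0, hδ⟩ := exists_integralCurve (G := G) (X : GroupLieAlgebra 𝓘(ℝ, E) G)
  have h1 : expE X = δ 1 := lieExp_eq (X : GroupLieAlgebra 𝓘(ℝ, E) G) hδ0 hδ
  rw [h1]
  refine isMIntegralCurveOn_Ioo_eqOn_of_contMDiff_boundaryless (t₀ := 0) (a := a) (b := b)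
    ⟨ha, by linarith⟩ (contMDiff_invariantField (X : GroupLieAlgebra 𝓘(ℝ, E) G))
    (hδ.isMIntegralCurveOn _) (fun t ht => ?_) (by rw [h0, hδ0]) ⟨by linarith, hb⟩
  exact ((hasMFDerivAt_iff_hasLogDerivAt (X : GroupLieAlgebra 𝓘(ℝ, E) G)).2
    (h t ht)).hasMFDerivWithinAt

theorem HasLogDerivAt.comp_mul {γ : ℝ → G} {X : E} {a t : ℝ} (h : HasLogDerivAt γ X (t * a)) :
    HasLogDerivAt (fun s => γ (s * a)) (a • X) t := by
  refine ⟨ContinuousAt.comp (f := fun s : ℝ => s * a) h.1 (by fun_prop), ?_⟩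
  have h2 : HasDerivAt (fun s : ℝ => s * a) a t := by simpa using (hasDerivAt_id t).mul_const a
  exact h.2.scomp t h2

theorem HasLogDerivAt.comp_add {γ : ℝ → G} {X : E} {a t : ℝ} (h : HasLogDerivAt γ X (t + a)) :
    HasLogDerivAt (fun s => γ (s + a)) X t := by
  refine ⟨ContinuousAt.comp (f := fun s : ℝ => s + a) h.1 (by fun_prop), ?_⟩
  have h2 : HasDerivAt (fun s : ℝ => s + a) 1 t := by simpa using (hasDerivAt_id t).add_const a
  simpa using! h.2.scomp t h2

theorem HasLogDerivAt.mul_left {γ : ℝ → G} {X : E} {t : ℝ} (h : HasLogDerivAt γ X t) (g : G) :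
    HasLogDerivAt (fun s => g * γ s) X t := by
  have : IsTopologicalGroup G := topologicalGroup_of_lieGroup 𝓘(ℝ, E) ∞
  refine ⟨continuousAt_const.mul h.1, ?_⟩
  simpa [mul_assoc] using h.2

theorem eq_expE_smul {γ : ℝ → G} {X : E} (h0 : γ 0 = 1) (h : ∀ t, HasLogDerivAt γ X t) (t : ℝ) :
    γ t = expE (t • X) := by
  rw [expE_eq_of_hasLogDerivAt (a := -1) (b := 2) (γ := fun s => γ (s * t)) (by norm_num)
    (by norm_num) (by simpa) (fun s _ => (h (s * t)).comp_mul)]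
  simp

theorem hasLogDerivAt_expE (X : E) (t : ℝ) : HasLogDerivAt (fun s : ℝ => (expE (s • X) : G)) X t := by
  obtain ⟨δ, hδ0, hδ⟩ := exists_integralCurve (G := G) (X : GroupLieAlgebra 𝓘(ℝ, E) G)
  have h : ∀ t, HasLogDerivAt δ X t := fun t =>
    (hasMFDerivAt_iff_hasLogDerivAt (X : GroupLieAlgebra 𝓘(ℝ, E) G)).1 (hδ t)
  have : (fun s : ℝ => (expE (s • X) : G)) = δ := by
    ext s
    rw [eq_expE_smul hδ0 h]
  rw [this]
  exact h t

@[simp] theorem expE_zero : (expE (0 : E) : G) = 1 := by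
  obtain ⟨δ, hδ0, hδ⟩ := exists_integralCurve (G := G) (0 : GroupLieAlgebra 𝓘(ℝ, E) G)
  have h : ∀ t, HasLogDerivAt δ (0 : E) t := fun t =>
    (hasMFDerivAt_iff_hasLogDerivAt (0 : GroupLieAlgebra 𝓘(ℝ, E) G)).1 (hδ t)
  simpa [hδ0] using (eq_expE_smul hδ0 h 0).symm

theorem expE_add_smul (X : E) (s t : ℝ) :
    (expE ((s + t) • X) : G) = expE (s • X) * expE (t • X) := by
  have h := eq_expE_smul (G := G) (γ := fun t : ℝ => (expE (s • X) : G)⁻¹ * expE ((t + s) • X))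
    (X := X) (by simp) (fun t => (hasLogDerivAt_expE X (t + s)).comp_add.mul_left _) t
  rw [← h, add_comm s t]
  simp

/-- A differentiable one-parameter subgroup is given by the exponential map. -/
theorem eq_expE_smul_of_hom {β : ℝ → G} {X : E} (hβ : ∀ s t, β (s + t) = β s * β t)
    (h : HasLogDerivAt β X 0) (t : ℝ) : β t = expE (t • X) := by
  have h0 : β 0 = 1 := by simpa using hβ 0 0
  refine eq_expE_smul h0 (fun t => ?_) t
  have h1 : HasLogDerivAt β X (t + -t) := by simpa using h
  have h2 := (h1.comp_add).mul_left (β t)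
  have : (fun s => β t * β (s + -t)) = β := by
    ext s
    rw [← hβ]
    simp
  rwa [this] at h2

/-- The conjugate of a one-parameter subgroup is again one, and its velocity at time `0` is `Ad g X`
by the chain rule. -/
theorem expE_conj (g : G) (X : E) : g * expE X * g⁻¹ = expE (Ad g X) := by
  have h := hasLogDerivAt_expE (G := G) X 0
  have := eq_expE_smul_of_hom (G := G) (β := fun t : ℝ => g * expE (t • X) * g⁻¹) (X := Ad g X)
    (fun s t => by rw [expE_add_smul]; group) ?_ 1
  · simpa using this
  have : IsTopologicalGroup G := topologicalGroup_of_lieGroup 𝓘(ℝ, E) ∞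
  refine ⟨(continuousAt_const.mul h.1).mul continuousAt_const, ?_⟩
  have h2 : HasDerivAt (fun s : ℝ => chartOne (E := E) G (expE (s • X))) X 0 := by
    simpa using h.2
  have h3 : HasFDerivAt (fun y => chartOne G (g * (chartOne G).symm y * g⁻¹)) (Ad (E := E) g)
      (chartOne G (expE ((0 : ℝ) • X))) := by
    simpa using hasFDerivAt_conj_chart (E := E) g
  have h4 := h3.comp_hasDerivAt (0 : ℝ) h2
  refine h4.congr_of_eventuallyEq ?_
  have hc : Tendsto (fun s : ℝ => (expE (s • X) : G)) (𝓝 0) (𝓝 1) := by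
    simpa using h.1.tendsto
  filter_upwards [hc.eventually (chartOne_symm_left_inv_eventually (E := E))] with s hs
  simp only [Function.comp]
  rw [hs]
  simp

/-- Solutions of the chart form of the exponential equation have constant logarithmic derivative. -/
theorem hasLogDerivAt_of_chart {α : ℝ → E} {X : E} {t : ℝ}
    (ht : α t ∈ (chartOne (E := E) G).target) (h : HasDerivAt α (leftD G (α t) X) t) :
    HasLogDerivAt (fun s => (chartOne (E := E) G).symm (α s)) X t := by
  set g := (chartOne (E := E) G).symm (α t) with hg
  have hs : ContMDiffAt 𝓘(ℝ, E) 𝓘(ℝ, E) ∞ (chartOne (E := E) G).symm (α t) :=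
    (contMDiffOn_extChartAt_symm (1 : G)).contMDiffAt
      (extChartAt_target_mem_nhds' (I := 𝓘(ℝ, E)) ht)
  refine ⟨ContinuousAt.comp (f := α) hs.continuousAt h.continuousAt, ?_⟩
  have hgs : g ∈ (chartOne (E := E) G).source := (chartOne (E := E) G).map_target ht
  have hH : DifferentiableAt ℝ (fun y => chartOne (E := E) G (g⁻¹ * (chartOne G).symm y)) (α t) := by
    have : ContMDiffAt 𝓘(ℝ, E) 𝓘(ℝ, E) ∞
        (fun y : E => chartOne (E := E) G (g⁻¹ * (chartOne G).symm y)) (α t) := by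
      refine ContMDiffAt.comp (I' := 𝓘(ℝ, E)) _ (contMDiffAt_chartOne ?_) (contMDiffAt_const.mul hs)
      simp [← hg, mem_chartOne_source]
    exact (contMDiffAt_iff_contDiffAt.1 this).differentiableAt (by simp)
  have hM : HasFDerivAt (fun y => chartMul G (α t, y)) (leftD G (α t)) (cOne E G) :=
    (differentiableAt_chart_comp (f := fun x => g * x) contMDiff_mul_left.contMDiffAt
      (by simpa using hgs)).hasFDerivAt
  have hMc : chartMul G (α t, cOne E G) = α t := by
    simp [chartMul, (chartOne (E := E) G).right_inv ht]
  -- Translating by `g` and then by `g⁻¹` is the identity, so the derivative of the second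
  -- translation cancels `leftD G (α t)` and only `X` is left.
  have hid : (fderiv ℝ (fun y => chartOne (E := E) G (g⁻¹ * (chartOne G).symm y)) (α t)).comp
      (leftD G (α t)) = 1 := by
    have h1 : HasFDerivAt (fun y => chartOne (E := E) G (g⁻¹ * (chartOne G).symm y))
        (fderiv ℝ (fun y => chartOne (E := E) G (g⁻¹ * (chartOne G).symm y)) (α t))
        (chartMul G (α t, cOne E G)) := by
      rw [hMc]; exact hH.hasFDerivAt
    refine (HasFDerivAt.comp (cOne E G) h1 hM).unique
      ((hasFDerivAt_id _).congr_of_eventuallyEq ?_)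
    have hc : Tendsto (fun y => g * (chartOne G).symm y) (𝓝 (cOne E G)) (𝓝 g) := by
      have h := ((contMDiff_mul_left (I := 𝓘(ℝ, E)) (n := ∞) (a := g)).continuous.tendsto 1).comp
        (tendsto_chartOne_symm (E := E) (G := G))
      simpa [Function.comp_def] using h
    have hgn : (chartOne (E := E) G).source ∈ 𝓝 g := extChartAt_source_mem_nhds' (I := 𝓘(ℝ, E)) hgs
    filter_upwards [hc.eventually hgn, chartOne_right_inv_eventually (E := E) (G := G)] with y hy hy2
    simp only [Function.comp, chartMul, ← hg]
    rw [(chartOne (E := E) G).left_inv hy]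
    simpa using hy2
  have := hH.hasFDerivAt.comp_hasDerivAt t h
  rw [← ContinuousLinearMap.comp_apply, hid] at this
  exact this

end LogDeriv

end LieKP

namespace LieKP

open scoped NNReal
open Filter Topology Set Metric

set_option linter.unusedSectionVars false

theorem exp_neg_mul_exp_self {A : Type*} [NormedRing A] [NormedAlgebra ℝ A] [CompleteSpace A]
    (x : A) : NormedSpace.exp (-x) * NormedSpace.exp x = 1 := by
  let : NormedAlgebra ℚ A := NormedAlgebra.restrictScalars ℚ ℝ A
  rw [← NormedSpace.exp_add_of_commute (Commute.neg_left (Commute.refl x))]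
  simp

/-! ### Ordinary differential equations: existence in a ball and dependence on the parameter. -/

section ODE

variable {E : Type*} [NormedAddCommGroup E] [NormedSpace ℝ E] [CompleteSpace E]

/-- Picard–Lindelöf, with the information that the solution stays in the ball. -/
theorem exists_solution_mem_closedBall {f : E → E} {c : E} {a L K : ℝ≥0}
    (hb : ∀ x ∈ closedBall c a, ‖f x‖ ≤ L) (hl : LipschitzOnWith K f (closedBall c a))
    (hm : L * 2 ≤ a) :
    ∃ α : ℝ → E, α 0 = c ∧ ∀ t ∈ Ioo (-2 : ℝ) 2, α t ∈ closedBall c a ∧ HasDerivAt α (f (α t)) t := by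
  have hf : IsPicardLindelof (fun _ => f) (tmin := -2) (tmax := 2) ⟨0, by norm_num, by norm_num⟩ c
      a 0 L K := by
    refine IsPicardLindelof.of_time_independent hb hl ?_
    simpa using (by exact_mod_cast hm : (L : ℝ) * 2 ≤ a)
  have hx : c ∈ closedBall c ((0 : ℝ≥0) : ℝ) := by simp
  obtain ⟨α, hα⟩ := ODE.FunSpace.exists_isFixedPt_next hf hx
  refine ⟨α.compProj, ?_, fun t ht => ⟨α.compProj_mem_closedBall hf.mul_max_le, ?_⟩⟩
  · have := ODE.FunSpace.compProj_val (α := α)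
      (t := ⟨0, by norm_num, by norm_num⟩)
    rw [this, ← hα, ODE.FunSpace.next_apply₀]
  · have h := ODE.hasDerivWithinAt_picard_Icc (f := fun _ => f) (u := closedBall c a)
      (tmin := -2) (tmax := 2) (t₀ := 0) (by norm_num) hf.continuousOn_uncurry
      α.continuous_compProj.continuousOn (fun _ _ => α.compProj_mem_closedBall hf.mul_max_le)
      c (Ioo_subset_Icc_self ht)
    have h2 : HasDerivWithinAt α.compProj (f (α.compProj t)) (Icc (-2) 2) t := by
      refine h.congr_of_mem (fun t' ht' => ?_) (Ioo_subset_Icc_self ht)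
      nth_rw 1 [← hα]
      rw [ODE.FunSpace.compProj_of_mem ht', ODE.FunSpace.next_apply]
    exact h2.hasDerivAt (Icc_mem_nhds ht.1 ht.2)

/-- Since `F` is within `K r` of the identity on the ball, the solutions of `α' = F(α) X` and `β' =
F(β) Y` separate almost linearly. The mean value inequality bounds the deviation by the maximal
distance `m` of the curves, and the smallness of `K r` and `‖X‖` lets `m` be absorbed into a
multiple of `‖X - Y‖`. -/
theorem norm_solution_sub_le {F : E → E →L[ℝ] E} {c : E} {r K : ℝ} {X Y : E} {α β : ℝ → E}
    (hK : 0 ≤ K) (hr : 0 ≤ r)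
    (hF1 : F c = 1)
    (hF : ∀ x ∈ closedBall c r, ∀ y ∈ closedBall c r, ‖F x - F y‖ ≤ K * ‖x - y‖)
    (hα0 : α 0 = c) (hβ0 : β 0 = c)
    (hα : ∀ t ∈ Icc (0 : ℝ) 1, α t ∈ closedBall c r ∧ HasDerivAt α (F (α t) X) t)
    (hβ : ∀ t ∈ Icc (0 : ℝ) 1, β t ∈ closedBall c r ∧ HasDerivAt β (F (β t) Y) t)
    (hKr : K * r ≤ 1) (hX : ‖X‖ ≤ r / 4) :
    ‖α 1 - β 1 - (X - Y)‖ ≤ 2 * K * r * ‖X - Y‖ := by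
  have hc : c ∈ closedBall c r := mem_closedBall_self hr
  have hcont : ContinuousOn (fun t => ‖α t - β t‖) (Icc (0 : ℝ) 1) := fun t ht =>
    ((hα t ht).2.continuousAt.sub (hβ t ht).2.continuousAt).norm.continuousWithinAt
  obtain ⟨t0, ht0, hmax⟩ := isCompact_Icc.exists_isMaxOn (nonempty_Icc.2 zero_le_one) hcont
  set m := ‖α t0 - β t0‖ with hm
  have hm0 : 0 ≤ m := norm_nonneg _
  have hd : ∀ t ∈ Icc (0 : ℝ) 1, HasDerivWithinAt (fun t => α t - β t - t • (X - Y))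
      (F (α t) X - F (β t) Y - (1 : ℝ) • (X - Y)) (Icc 0 1) t := fun t ht =>
    (((hα t ht).2.sub (hβ t ht).2).sub ((hasDerivAt_id t).smul_const (X - Y))).hasDerivWithinAt
  have hbound : ∀ t ∈ Icc (0 : ℝ) 1, ‖F (α t) X - F (β t) Y - (1 : ℝ) • (X - Y)‖ ≤
      K * m * ‖X‖ + K * r * ‖X - Y‖ := by
    intro t ht
    have e : F (α t) X - F (β t) Y - (1 : ℝ) • (X - Y) =
        (F (α t) - F (β t)) X + (F (β t) - F c) (X - Y) := by
      simp [hF1]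
      abel
    rw [e]
    have h1 : ‖F (α t) - F (β t)‖ ≤ K * m :=
      (hF _ (hα t ht).1 _ (hβ t ht).1).trans (by gcongr; exact hmax ht)
    have h2 : ‖F (β t) - F c‖ ≤ K * r :=
      (hF _ (hβ t ht).1 _ hc).trans (by gcongr; simpa [dist_eq_norm] using (hβ t ht).1)
    exact (norm_add_le _ _).trans (add_le_add
      (((F (α t) - F (β t)).le_opNorm X).trans (by gcongr))
      (((F (β t) - F c).le_opNorm _).trans (by gcongr)))
  have hmv : ∀ t ∈ Icc (0 : ℝ) 1, ‖α t - β t - t • (X - Y)‖ ≤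
      K * m * ‖X‖ + K * r * ‖X - Y‖ := by
    intro t ht
    have h := (convex_Icc (0 : ℝ) 1).norm_image_sub_le_of_norm_hasDerivWithin_le hd hbound
      (left_mem_Icc.2 zero_le_one) ht
    simp only [hα0, hβ0, sub_self, zero_smul, sub_zero] at h
    refine h.trans (mul_le_of_le_one_right (by positivity) ?_)
    simpa [abs_of_nonneg ht.1] using ht.2
  have hm1 : m ≤ K * m * ‖X‖ + K * r * ‖X - Y‖ + ‖X - Y‖ := by
    have h := hmv t0 ht0
    have h2 : m ≤ ‖α t0 - β t0 - t0 • (X - Y)‖ + ‖t0 • (X - Y)‖ := by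
      rw [hm]; exact norm_le_norm_sub_add _ _
    have h3 : ‖t0 • (X - Y)‖ ≤ ‖X - Y‖ := by
      rw [norm_smul]
      exact mul_le_of_le_one_left (norm_nonneg _) (by simpa [abs_of_nonneg ht0.1] using ht0.2)
    linarith
  have hKX : K * ‖X‖ ≤ K * r / 4 := by
    have := mul_le_mul_of_nonneg_left hX hK
    linarith
  have h5 : K * m * ‖X‖ ≤ m * (K * r / 4) := by
    have := mul_le_mul_of_nonneg_left hKX hm0
    linarith
  have h6 : K * r * ‖X - Y‖ ≤ ‖X - Y‖ := mul_le_of_le_one_left (norm_nonneg _) hKr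
  have h8 : m * (K * r / 4) ≤ m / 4 := by
    have := mul_le_mul_of_nonneg_left hKr hm0
    linarith
  have h7 : m ≤ 4 * ‖X - Y‖ := by linarith
  have h := hmv 1 (right_mem_Icc.2 zero_le_one)
  rw [one_smul] at h
  have h9 : m * (K * r / 4) ≤ 4 * ‖X - Y‖ * (K * r / 4) :=
    mul_le_mul_of_nonneg_right h7 (by positivity)
  linarith

end ODE

/-! ### Continuity and derivative of the exponential map. -/

section Exp

variable {E : Type*} [NormedAddCommGroup E] [NormedSpace ℝ E] [CompleteSpace E]
  {G : Type*} [TopologicalSpace G] [T2Space G] [ChartedSpace E G] [Group G]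
  [LieGroup 𝓘(ℝ, E) ∞ G]

/-- In the chart, `expE X` is the time-one value of the solution of `α' = leftD(α) X`, and `leftD`
is Lipschitz near the identity. The last bound is strict differentiability at `0` with derivative
`1`. -/
theorem chart_expE_estimate {ε : ℝ} (hε : 0 < ε) : ∃ ρ > 0, ∀ X Y : E, ‖X‖ ≤ ρ → ‖Y‖ ≤ ρ →
    (expE X : G) ∈ (chartOne (E := E) G).source ∧
    ‖chartOne (E := E) G (expE X) - cOne E G‖ ≤ ε ∧
    ‖chartOne (E := E) G (expE X) - chartOne (E := E) G (expE Y) - (X - Y)‖ ≤ ε * ‖X - Y‖ := by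
  obtain ⟨K, s, hs, hK⟩ := ((contDiffAt_leftD (E := E) (G := G)).of_le
    (m := 1) (by simp)).exists_lipschitzOnWith
  have ht : (chartOne (E := E) G).target ∈ 𝓝 (cOne E G) :=
    extChartAt_target_mem_nhds (I := 𝓘(ℝ, E)) (1 : G)
  obtain ⟨r0, hr0, hball⟩ := Metric.nhds_basis_closedBall.mem_iff.1 (inter_mem hs ht)
  obtain ⟨r, hr, hrr0, hKr, hrε, hKrε⟩ : ∃ r : ℝ, 0 < r ∧ r ≤ r0 ∧ K * r ≤ 1 ∧ r ≤ ε ∧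
      2 * K * r ≤ ε := by
    refine ⟨min (min r0 ε) (min (1 / (K + 1)) (ε / (2 * K + 1))), by positivity,
      (min_le_left _ _).trans (min_le_left _ _), ?_, (min_le_left _ _).trans (min_le_right _ _), ?_⟩
    · calc (K : ℝ) * _ ≤ (K + 1) * (1 / (K + 1)) := by
            gcongr
            · linarith
            · exact (min_le_right _ _).trans (min_le_left _ _)
        _ = 1 := by field_simp
    · calc 2 * (K : ℝ) * _ ≤ (2 * K + 1) * (ε / (2 * K + 1)) := by
            gcongr
            · linarith
            · exact (min_le_right _ _).trans (min_le_right _ _)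
        _ = ε := by field_simp
  lift r to ℝ≥0 using hr.le
  have hsub : closedBall (cOne E G) r ⊆ closedBall (cOne E G) r0 := closedBall_subset_closedBall hrr0
  have hF : ∀ x ∈ closedBall (cOne E G) r, ∀ y ∈ closedBall (cOne E G) r,
      ‖leftD G x - leftD G y‖ ≤ K * ‖x - y‖ := fun x hx y hy => by
    simpa [dist_eq_norm] using hK.dist_le_mul x (hball (hsub hx)).1 y (hball (hsub hy)).1
  have hF2 : ∀ x ∈ closedBall (cOne E G) r, ‖leftD G x‖ ≤ 2 := fun x hx => by
    have h1 := hF x hx _ (mem_closedBall_self hr.le)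
    rw [leftD_cOne] at h1
    have h2 : ‖(1 : E →L[ℝ] E)‖ ≤ 1 := ContinuousLinearMap.norm_id_le
    have h3 : ‖x - cOne E G‖ ≤ r := by simpa [dist_eq_norm] using hx
    have h4 : K * ‖x - cOne E G‖ ≤ K * r := by gcongr
    have h5 := norm_le_norm_sub_add (leftD G x) 1
    linarith
  have hex : ∀ X : E, ‖X‖ ≤ r / 4 → ∃ α : ℝ → E, α 0 = cOne E G ∧
      (∀ t ∈ Ioo (-2 : ℝ) 2, α t ∈ closedBall (cOne E G) r ∧ HasDerivAt α (leftD G (α t) X) t) ∧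
      (expE X : G) ∈ (chartOne (E := E) G).source ∧ chartOne (E := E) G (expE X) = α 1 := by
    intro X hX
    -- The speed is at most `2 · r/4 = r/2`, so the solution stays in the ball of radius `r` up to
    -- time `2`; time `1` is then interior to the interval of existence.
    obtain ⟨α, hα0, hα⟩ := exists_solution_mem_closedBall (f := fun x => leftD G x X)
      (c := cOne E G) (a := r) (L := r / 2) (K := K * ‖X‖₊)
      (fun x hx => ((leftD G x).le_opNorm X).trans (by
        have := mul_le_mul (hF2 x hx) hX (norm_nonneg _) zero_le_two
        rw [NNReal.coe_div, NNReal.coe_ofNat]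
        linarith))
      (LipschitzOnWith.of_dist_le_mul fun x hx y hy => by
        rw [dist_eq_norm, dist_eq_norm, ← sub_apply]
        refine ((leftD G x - leftD G y).le_opNorm X).trans ?_
        have := mul_le_mul_of_nonneg_right (hF x hx y hy) (norm_nonneg X)
        simp only [NNReal.coe_mul, coe_nnnorm]
        linarith)
      (by simp)
    have hα' : ∀ t ∈ Ioo (-2 : ℝ) 2, HasLogDerivAt (fun s => (chartOne (E := E) G).symm (α s)) X t :=
      fun t ht => hasLogDerivAt_of_chart (hball (hsub (hα t ht).1)).2 (hα t ht).2
    have h1 : expE X = (chartOne (E := E) G).symm (α 1) :=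
      expE_eq_of_hasLogDerivAt (a := -2) (b := 2) (by norm_num) (by norm_num) (by simp [hα0]) hα'
    have h2 := (hball (hsub (hα 1 (by norm_num)).1)).2
    refine ⟨α, hα0, hα, ?_, ?_⟩
    · rw [h1]; exact (chartOne (E := E) G).map_target h2
    · rw [h1]; exact (chartOne (E := E) G).right_inv h2
  refine ⟨r / 4, by positivity, fun X Y hX hY => ?_⟩
  obtain ⟨α, hα0, hα, hαs, hα1⟩ := hex X hX
  obtain ⟨β, hβ0, hβ, -, hβ1⟩ := hex Y hY
  refine ⟨hαs, ?_, ?_⟩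
  · rw [hα1, ← dist_eq_norm]
    exact (hα 1 (by norm_num)).1.trans hrε
  · rw [hα1, hβ1]
    have hI : Icc (0 : ℝ) 1 ⊆ Ioo (-2) 2 := fun t ht => ⟨by linarith [ht.1], by linarith [ht.2]⟩
    refine (norm_solution_sub_le K.2 r.2 leftD_cOne hF hα0 hβ0 (fun t ht => hα t (hI ht))
      (fun t ht => hβ t (hI ht)) hKr hX).trans ?_
    exact mul_le_mul_of_nonneg_right hKrε (norm_nonneg _)

theorem hasStrictFDerivAt_chart_expE :
    HasStrictFDerivAt (fun X : E => chartOne (E := E) G (expE X)) (1 : E →L[ℝ] E) 0 := by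
  rw [hasStrictFDerivAt_iff_isLittleO, Asymptotics.isLittleO_iff]
  intro ε hε
  obtain ⟨ρ, hρ, h⟩ := chart_expE_estimate (E := E) (G := G) hε
  have : closedBall (0 : E) ρ ×ˢ closedBall (0 : E) ρ ∈ 𝓝 ((0 : E), (0 : E)) :=
    prod_mem_nhds (closedBall_mem_nhds _ hρ) (closedBall_mem_nhds _ hρ)
  filter_upwards [this] with p hp
  exact (h p.1 p.2 (by simpa using hp.1) (by simpa using hp.2)).2.2

theorem expE_nsmul (n : ℕ) (X : E) : (expE ((n : ℝ) • X) : G) = expE X ^ n := by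
  induction n with
  | zero => simp
  | succ n ih => simp [expE_add_smul, ih, pow_succ]

/-- The exponential map is continuous. -/
theorem continuous_expE : Continuous (expE : E → G) := by
  have : IsTopologicalGroup G := topologicalGroup_of_lieGroup 𝓘(ℝ, E) ∞
  obtain ⟨ρ, hρ, h⟩ := chart_expE_estimate (E := E) (G := G) one_pos
  have h1 : ContinuousOn (fun X : E => chartOne (E := E) G (expE X)) (closedBall 0 ρ) := by
    refine (LipschitzOnWith.of_dist_le_mul (K := 2) fun X hX Y hY => ?_).continuousOn
    have h2 := (h X Y (by simpa using hX) (by simpa using hY)).2.2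
    rw [dist_eq_norm, dist_eq_norm]
    have h3 := norm_le_norm_sub_add
      (chartOne (E := E) G (expE X) - chartOne (E := E) G (expE Y)) (X - Y)
    rw [NNReal.coe_ofNat]
    linarith
  have h2 : ContinuousOn (expE : E → G) (closedBall 0 ρ) := by
    have hs : ContinuousOn (chartOne (E := E) G).symm (chartOne (E := E) G).target :=
      continuousOn_extChartAt_symm (I := 𝓘(ℝ, E)) (1 : G)
    have hmem : ∀ X ∈ closedBall (0 : E) ρ, (expE X : G) ∈ (chartOne (E := E) G).source :=
      fun X hX => (h X X (by simpa using hX) (by simpa using hX)).1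
    refine (hs.comp h1 fun X hX => (chartOne (E := E) G).map_source (hmem X hX)).congr
      fun X hX => ?_
    exact ((chartOne (E := E) G).left_inv (hmem X hX)).symm
  rw [continuous_iff_continuousAt]
  intro X
  -- Continuity away from `0` comes from `expE Y = expE (Y / n) ^ n`, with `n` so large that `X / n`
  -- lies in the small ball.
  obtain ⟨n, hn⟩ := exists_nat_gt (‖X‖ / ρ)
  have hn0 : (0 : ℝ) < n := lt_of_le_of_lt (by positivity) hn
  have hX : (n : ℝ)⁻¹ • X ∈ ball (0 : E) ρ := by
    rw [mem_ball_zero_iff, norm_smul, norm_inv, Real.norm_of_nonneg hn0.le, inv_mul_lt_iff₀ hn0,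
      mul_comm]
    rwa [div_lt_iff₀ hρ, mul_comm] at hn
  have h3 : ContinuousAt (expE : E → G) ((n : ℝ)⁻¹ • X) :=
    h2.continuousAt (mem_of_superset (isOpen_ball.mem_nhds hX) ball_subset_closedBall)
  have h4 : ContinuousAt (fun Y : E => (expE ((n : ℝ)⁻¹ • Y) : G) ^ n) X :=
    (ContinuousAt.comp (f := fun Y : E => (n : ℝ)⁻¹ • Y) h3 (by fun_prop)).pow n
  refine h4.congr (Eventually.of_forall fun Y => ?_)
  simp only
  rw [← expE_nsmul, smul_smul, mul_inv_cancel₀ hn0.ne', one_smul]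

/-- The exponential map relates the adjoint representations of the group and the Lie algebra. -/
theorem Ad_expE (X : E) : Ad (expE X : G) = NormedSpace.exp (chartAd G X : E →L[ℝ] E) := by
  set D : E →L[ℝ] E := chartAd G X with hD
  set A : ℝ → E →L[ℝ] E := fun t => Ad (expE (t • X) : G) with hA
  have hA0 : A 0 = 1 := by simp [hA]
  have hAadd : ∀ s t, A (s + t) = A s * A t := fun s t => by
    simp only [hA]
    rw [expE_add_smul, Ad_mul]
    rfl
  have hd0 : HasDerivAt A D 0 := by
    have h1 : HasDerivAt (fun s : ℝ => chartOne (E := E) G (expE (s • X))) X 0 := by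
      simpa using (hasLogDerivAt_expE (G := G) X 0).2
    have h2 : HasFDerivAt (fun x : E => Ad (E := E) ((chartOne G).symm x)) (chartAd G)
        (chartOne (E := E) G (expE ((0 : ℝ) • X))) := by
      simpa using hasFDerivAt_Ad_chart (E := E) (G := G)
    refine (h2.comp_hasDerivAt (0 : ℝ) h1).congr_of_eventuallyEq ?_
    have hc : Tendsto (fun s : ℝ => (expE (s • X) : G)) (𝓝 0) (𝓝 1) := by
      simpa using (hasLogDerivAt_expE (G := G) X 0).1.tendsto
    filter_upwards [hc.eventually (chartOne_symm_left_inv_eventually (E := E))] with s hs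
    simp only [Function.comp, hA]
    rw [hs]
  have hd : ∀ t, HasDerivAt A (A t * D) t := by
    intro t
    have h1 : HasDerivAt A D (t + -t) := by simpa using hd0
    have h2 := (h1.comp_add_const t (-t)).const_mul (A t)
    refine h2.congr_of_eventuallyEq (Eventually.of_forall fun s => ?_)
    simp [← hAadd]
  -- Both `A t` and `exp (tD)` solve `A' = A D` with value `1` at `0`; their quotient is constant.
  have hconst : ∀ t, HasDerivAt (fun t : ℝ => A t * NormedSpace.exp (t • -D)) 0 t := by
    intro t
    have h := (hd t).mul (hasDerivAt_exp_smul_const' (𝕂 := ℝ) (-D) t)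
    exact h.congr_deriv (by simp [mul_assoc])
  have h1 := is_const_of_deriv_eq_zero (fun t => (hconst t).differentiableAt)
    (fun t => (hconst t).deriv) 1 0
  simp only [one_smul, zero_smul, hA0, NormedSpace.exp_zero, mul_one] at h1
  have h2 := exp_neg_mul_exp_self D
  calc Ad (expE X : G) = A 1 := by simp [hA]
    _ = A 1 * NormedSpace.exp (-D) * NormedSpace.exp D := by rw [mul_assoc, h2, mul_one]
    _ = _ := by rw [h1, one_mul]

end Exp

end LieKP

namespace LieKP

open scoped NNReal
open Filter Topology Set Metric

set_option linter.unusedSectionVars false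

/-! ### Local product coordinates and the Lie bracket. -/

section Local

variable {E : Type*} [NormedAddCommGroup E] [NormedSpace ℝ E] [CompleteSpace E]
  {G : Type*} [TopologicalSpace G] [T2Space G] [ChartedSpace E G] [Group G]
  [LieGroup 𝓘(ℝ, E) ∞ G]

theorem eq_zero_of_expE_smul_eq_one {X : E} (h : ∀ t : ℝ, (expE (t • X) : G) = 1) : X = 0 := by
  have h1 := (hasLogDerivAt_expE (G := G) X 0).2
  simp only [h] at h1
  exact h1.unique (hasDerivAt_const _ _)

theorem fderiv_chartMul_cOne_apply (u v : E) :
    fderiv ℝ (chartMul (E := E) G) (cOne E G, cOne E G) (u, v) = u + v := by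
  have hM : HasFDerivAt (chartMul (E := E) G) _ (cOne E G, cOne E G) :=
    (contDiffAt_chartMul.differentiableAt (by simp)).hasFDerivAt
  have h1 : leftD G (cOne E G) v = fderiv ℝ (chartMul (E := E) G) (cOne E G, cOne E G) (0, v) := by
    have := (HasFDerivAt.comp (cOne E G) (g := chartMul (E := E) G) (f := fun y => (cOne E G, y)) hM
      (hasFDerivAt_prodMk_right _ _)).fderiv
    rw [leftD]
    simpa [Function.comp_def] using congrArg (fun L : E →L[ℝ] E => L v) this
  have h2 : rightD G (cOne E G) u = fderiv ℝ (chartMul (E := E) G) (cOne E G, cOne E G) (u, 0) := by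
    have := (HasFDerivAt.comp (cOne E G) (f := fun y => (y, cOne E G)) hM
      (hasFDerivAt_prodMk_left _ _)).fderiv
    rw [rightD]
    simpa [Function.comp_def] using congrArg (fun L : E →L[ℝ] E => L u) this
  rw [leftD_cOne] at h1
  rw [rightD_cOne] at h2
  have h3 : (u, v) = (u, (0 : E)) + ((0 : E), v) := by simp
  rw [h3, map_add, ← h1, ← h2]
  rfl

/-- If `P + Q = 1`, then `U ↦ exp (P U) * exp (Q U)` is open at `0`. -/
theorem image_expE_mul_expE_mem_nhds {P Q : E →L[ℝ] E} (hPQ : P + Q = 1) {W : Set E}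
    (hW : W ∈ 𝓝 (0 : E)) : (fun U => (expE (P U) * expE (Q U) : G)) '' W ∈ 𝓝 1 := by
  have : IsTopologicalGroup G := topologicalGroup_of_lieGroup 𝓘(ℝ, E) ∞
  set Φ : E → G := fun U => expE (P U) * expE (Q U) with hΦ
  have hΦ0 : Φ 0 = 1 := by simp [hΦ]
  have hΦc : Continuous Φ :=
    (continuous_expE.comp P.continuous).mul (continuous_expE.comp Q.continuous)
  have he : HasStrictFDerivAt (fun X : E => chartOne (E := E) G (expE X)) (1 : E →L[ℝ] E) 0 :=
    hasStrictFDerivAt_chart_expE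
  have hcomp : ∀ R : E →L[ℝ] E,
      HasStrictFDerivAt (fun U : E => chartOne (E := E) G (expE (R U))) R 0 := fun R => by
    have h1 : HasStrictFDerivAt (fun X : E => chartOne (E := E) G (expE X)) (1 : E →L[ℝ] E) (R 0) := by
      simpa using he
    exact h1.comp 0 R.hasStrictFDerivAt
  have hM : HasStrictFDerivAt (chartMul (E := E) G)
      (fderiv ℝ (chartMul (E := E) G) (cOne E G, cOne E G))
      (chartOne (E := E) G (expE (P 0)), chartOne (E := E) G (expE (Q 0))) := by
    simpa using contDiffAt_chartMul.hasStrictFDerivAt (by simp)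
  have h2 := HasStrictFDerivAt.comp (0 : E)
    (f := fun U => (chartOne (E := E) G (expE (P U)), chartOne (E := E) G (expE (Q U))))
    hM ((hcomp P).prodMk (hcomp Q))
  have hexp : ∀ R : E →L[ℝ] E, ∀ᶠ U in 𝓝 (0 : E),
      (chartOne (E := E) G).symm (chartOne (E := E) G (expE (R U))) = expE (R U) := fun R => by
    have : Tendsto (fun U => (expE (R U) : G)) (𝓝 0) (𝓝 1) := by
      simpa [Function.comp_def] using
        ((continuous_expE (E := E) (G := G)).comp R.continuous).tendsto (0 : E)
    exact this.eventually (chartOne_symm_left_inv_eventually (E := E))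
  have h3 : HasStrictFDerivAt (fun U => chartOne (E := E) G (Φ U))
      (ContinuousLinearEquiv.refl ℝ E : E →L[ℝ] E) 0 := by
    have e : (fderiv ℝ (chartMul (E := E) G) (cOne E G, cOne E G)).comp (P.prod Q) =
        (ContinuousLinearEquiv.refl ℝ E : E →L[ℝ] E) := by
      ext U
      simp only [ContinuousLinearMap.comp_apply, ContinuousLinearMap.prod_apply,
        fderiv_chartMul_cOne_apply]
      exact congrArg (fun L : E →L[ℝ] E => L U) hPQ
    rw [e] at h2
    refine h2.congr_of_eventuallyEq ?_
    filter_upwards [hexp P, hexp Q] with U h1 h2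
    simp only [chartMul, hΦ]
    rw [h1, h2]
  -- The derivative at `0` is `P + Q = 1`, so the inverse function theorem makes the map open there.
  have hmap := h3.map_nhds_eq_of_equiv
  rw [hΦ0, chartOne_one] at hmap
  have hs : (chartOne (E := E) G).source ∈ 𝓝 (1 : G) :=
    extChartAt_source_mem_nhds (I := 𝓘(ℝ, E)) (1 : G)
  have hW' : W ∩ Φ ⁻¹' (chartOne (E := E) G).source ∈ 𝓝 (0 : E) :=
    inter_mem hW (hΦc.continuousAt.preimage_mem_nhds (by rwa [hΦ0]))
  have himg : (fun U => chartOne (E := E) G (Φ U)) '' (W ∩ Φ ⁻¹' (chartOne (E := E) G).source) ∈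
      𝓝 (cOne E G) := by
    rw [← hmap]
    exact image_mem_map hW'
  have hpre := continuousAt_chartOne (E := E) (G := G) himg
  filter_upwards [hpre, hs] with g ⟨U, ⟨hUW, hUs⟩, hU⟩ hg
  exact ⟨U, hUW, (chartOne (E := E) G).injOn hUs hg hU⟩

/-- A curve through `y` with velocity `leftD G y X` is carried by the inverse chart to a curve with
logarithmic derivative `X`. So `y ↦ leftD G y X` is the invariant field read in the chart, which
reduces the bracket to a bracket of vector fields on `E`. -/
theorem mfderiv_chartOne_symm_leftD (X : E) {y : E}
    (hy : y ∈ (chartOne (E := E) G).target) :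
    (mfderiv 𝓘(ℝ, E) 𝓘(ℝ, E) (chartOne (E := E) G).symm y : E →L[ℝ] E) (leftD G y X) =
      mulInvariantVectorField (X : GroupLieAlgebra 𝓘(ℝ, E) G) ((chartOne (E := E) G).symm y) := by
  have hs : ContMDiffAt 𝓘(ℝ, E) 𝓘(ℝ, E) ∞ (chartOne (E := E) G).symm y :=
    (contMDiffOn_extChartAt_symm (1 : G)).contMDiffAt
      (extChartAt_target_mem_nhds' (I := 𝓘(ℝ, E)) hy)
  obtain ⟨α, hα0, hα⟩ : ∃ α : ℝ → E, α 0 = y ∧ HasDerivAt α (leftD G y X) 0 := by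
    refine ⟨fun t => y + t • leftD G y X, by simp, ?_⟩
    simpa using ((hasDerivAt_id (0 : ℝ)).smul_const (leftD G y X)).const_add y
  subst hα0
  have h1 := (hasMFDerivAt_iff_hasLogDerivAt (X : GroupLieAlgebra 𝓘(ℝ, E) G)).2 (hasLogDerivAt_of_chart hy hα)
  have h2 := (hs.mdifferentiableAt (by simp)).hasMFDerivAt.comp (0 : ℝ) hα.hasFDerivAt.hasMFDerivAt
  have h3 := hasMFDerivAt_unique h2 h1
  have h4 := congrArg (fun L : ℝ →L[ℝ] E => L 1) h3
  have e : ∀ (L : E →L[ℝ] E) (v : E), L.comp (ContinuousLinearMap.toSpanSingleton ℝ v) 1 = L v := by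
    intro L v
    simp
  have e2 : ∀ v : E, ((1 : ℝ →L[ℝ] ℝ).smulRight v) 1 = v := by simp
  exact (e _ _).symm.trans (h4.trans (e2 _))

theorem mpullbackWithin_chartOne_symm (X : E) {y : E} (hy : y ∈ (chartOne (E := E) G).target) :
    VectorField.mpullbackWithin 𝓘(ℝ, E) 𝓘(ℝ, E) (chartOne (E := E) G).symm
      (mulInvariantVectorField (X : GroupLieAlgebra 𝓘(ℝ, E) G)) univ y = leftD G y X := by
  have : IsManifold 𝓘(ℝ, E) 1 G := IsManifold.of_le (n := ∞) (by simp)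
  have hinv : (mfderivWithin 𝓘(ℝ, E) 𝓘(ℝ, E) (chartOne (E := E) G).symm univ y).IsInvertible := by
    have := isInvertible_mfderivWithin_extChartAt_symm (I := 𝓘(ℝ, E)) (x := (1 : G)) hy
    rwa [ModelWithCorners.range_eq_univ] at this
  rw [VectorField.mpullbackWithin_apply]
  have h1 := mfderiv_chartOne_symm_leftD X hy
  rw [← mfderivWithin_univ] at h1
  refine (congrArg (fun v => (mfderivWithin 𝓘(ℝ, E) 𝓘(ℝ, E) (chartOne (E := E) G).symm univ
    y).inverse v) h1.symm).trans ?_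
  have key : ∀ L : E →L[ℝ] E, L.IsInvertible → ∀ v, L.inverse (L v) = v := by
    rintro _ ⟨M, rfl⟩ v
    simp
  exact key _ hinv _

/-- The bracket of the Lie algebra in terms of the multiplication in the chart. -/
theorem lie_eq_chartAd (X Y : GroupLieAlgebra 𝓘(ℝ, E) G) :
    ⁅X, Y⁆ = chartAd (E := E) G X Y := by
  have : IsManifold 𝓘(ℝ, E) 1 G := IsManifold.of_le (n := ∞) (by simp)
  rw [GroupLieAlgebra.bracket_def, ← VectorField.mlieBracketWithin_univ,
    VectorField.mlieBracketWithin_apply, mfderiv_extChartAt_self]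
  simp only [ModelWithCorners.range_eq_univ, preimage_univ, inter_self]
  have hV : ∀ X : E, VectorField.mpullbackWithin 𝓘(ℝ, E) 𝓘(ℝ, E) (chartOne (E := E) G).symm
      (mulInvariantVectorField (X : GroupLieAlgebra 𝓘(ℝ, E) G)) univ =ᶠ[𝓝 (cOne E G)]
      fun y => leftD G y X := fun X => by
    filter_upwards [extChartAt_target_mem_nhds (I := 𝓘(ℝ, E)) (1 : G)] with y hy
    exact mpullbackWithin_chartOne_symm X hy
  have hd : ∀ X : E, HasFDerivAt (fun y => leftD G y X)
      ((fderiv ℝ (leftD G) (cOne E G)).flip X) (cOne E G) := fun X => by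
    have h := ((contDiffAt_leftD (E := E) (G := G)).differentiableAt (by simp)).hasFDerivAt
    simpa using h.clm_apply (hasFDerivAt_const X _)
  have key : VectorField.lieBracket ℝ
      (VectorField.mpullbackWithin 𝓘(ℝ, E) 𝓘(ℝ, E) (chartOne (E := E) G).symm
        (mulInvariantVectorField (X : GroupLieAlgebra 𝓘(ℝ, E) G)) univ)
      (VectorField.mpullbackWithin 𝓘(ℝ, E) 𝓘(ℝ, E) (chartOne (E := E) G).symm
        (mulInvariantVectorField (Y : GroupLieAlgebra 𝓘(ℝ, E) G)) univ) (cOne E G) =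
      chartAd (E := E) G X Y := by
    refine (((hV X).lieBracket_vectorField_eq (hV Y)).trans ?_)
    rw [VectorField.lieBracket_eq]
    simp only [(hd X).fderiv, (hd Y).fderiv, leftD_cOne]
    rfl
  have huniv : ∀ (V W : E → E) (x : E), VectorField.lieBracketWithin ℝ V W univ x =
      VectorField.lieBracket ℝ V W x := fun V W x => by rw [VectorField.lieBracketWithin_univ]
  have hid : ∀ v : E, (ContinuousLinearMap.id ℝ E).inverse v = v := by simp
  exact (hid _).trans ((huniv _ _ _).trans key)

end Local

end LieKP

namespace LieKP

open scoped NNReal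
open Filter Topology Set Metric NormedSpace

set_option linter.unusedSectionVars false

/-! ### Exponential estimates in a Banach algebra. -/

section BanachAlgebra

variable {A : Type*} [NormedRing A] [NormedAlgebra ℝ A] [CompleteSpace A]

theorem exists_exp_bounds (A : Type*) [NormedRing A] [NormedAlgebra ℝ A] [CompleteSpace A] :
    ∃ r > 0, ∃ C ≥ 1, ∀ x y : A, ‖x‖ ≤ r → ‖y‖ ≤ r →
      ‖exp x‖ ≤ C ∧ ‖exp x - exp y‖ ≤ C * ‖x - y‖ := by
  have h := hasStrictFDerivAt_exp_zero (𝕂 := ℝ) (𝔸 := A)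
  obtain ⟨K, s, hs, hK⟩ := h.exists_lipschitzOnWith
  obtain ⟨r, hr, hball⟩ := Metric.nhds_basis_closedBall.mem_iff.1 hs
  have hmem : ∀ x : A, ‖x‖ ≤ r → x ∈ s := fun x hx => hball (by simpa using hx)
  have hl : ∀ x y : A, ‖x‖ ≤ r → ‖y‖ ≤ r → ‖exp x - exp y‖ ≤ K * ‖x - y‖ := fun x y hx hy => by
    simpa [dist_eq_norm] using hK.dist_le_mul x (hmem x hx) y (hmem y hy)
  have h1 : 0 ≤ ‖(1 : A)‖ := norm_nonneg _
  have hK0 : (0 : ℝ) ≤ K := K.2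
  refine ⟨r, hr, 1 + K + K * r + ‖(1 : A)‖, by
    have : 0 ≤ K * r := by positivity
    simp only [ge_iff_le]; linarith, fun x y hx hy => ⟨?_, ?_⟩⟩
  · have h2 := hl x 0 hx (by simpa using hr.le)
    rw [exp_zero, sub_zero] at h2
    have h3 := norm_le_norm_sub_add (exp x) 1
    have h4 : K * ‖x‖ ≤ K * r := by gcongr
    linarith
  · refine (hl x y hx hy).trans (mul_le_mul_of_nonneg_right ?_ (norm_nonneg _))
    have : 0 ≤ K * r := by positivity
    linarith

theorem hasDerivAt_exp_neg_mul_exp (a h : A) (s : ℝ) :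
    HasDerivAt (fun s : ℝ => exp (s • -a) * exp (s • (a + h)))
      (exp (s • -a) * h * exp (s • (a + h))) s := by
  refine ((hasDerivAt_exp_smul_const (𝕂 := ℝ) (-a) s).mul
    (hasDerivAt_exp_smul_const' (𝕂 := ℝ) (a + h) s)).congr_deriv ?_
  noncomm_ring

theorem norm_smul_le_of_mem_Icc {a : A} {s : ℝ} (hs : s ∈ Icc (0 : ℝ) 1) : ‖s • a‖ ≤ ‖a‖ := by
  rw [norm_smul]
  exact mul_le_of_le_one_left (norm_nonneg _) (by simpa [abs_of_nonneg hs.1] using hs.2)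

variable {r C : ℝ} (hC1 : 1 ≤ C)
  (hC : ∀ x y : A, ‖x‖ ≤ r → ‖y‖ ≤ r → ‖exp x‖ ≤ C ∧ ‖exp x - exp y‖ ≤ C * ‖x - y‖)

include hC1 hC in
theorem norm_conj_sub_le {a a' h : A} (ha : ‖a‖ ≤ r) (ha' : ‖a'‖ ≤ r) (hr : 0 ≤ r) :
    ‖exp (-a) * h * exp a' - h‖ ≤ C ^ 2 * (‖a‖ + ‖a'‖) * ‖h‖ := by
  have h0 : ‖(0 : A)‖ ≤ r := by simpa using hr
  have h1 := (hC (-a) 0 (by simpa using ha) h0).2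
  have h2 := (hC a' 0 ha' h0).2
  have h3 := (hC a' 0 ha' h0).1
  rw [exp_zero, sub_zero] at h1 h2
  rw [norm_neg] at h1
  have e : exp (-a) * h * exp a' - h = (exp (-a) - 1) * h * exp a' + h * (exp a' - 1) := by
    noncomm_ring
  rw [e]
  calc _ ≤ ‖exp (-a) - 1‖ * ‖h‖ * ‖exp a'‖ + ‖h‖ * ‖exp a' - 1‖ :=
        (norm_add_le _ _).trans (add_le_add ((norm_mul_le _ _).trans
          (mul_le_mul_of_nonneg_right (norm_mul_le _ _) (norm_nonneg _))) (norm_mul_le _ _))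
    _ ≤ (C * ‖a‖) * ‖h‖ * C + ‖h‖ * (C * ‖a'‖) := by gcongr
    _ ≤ (C * ‖a‖) * ‖h‖ * C + ‖h‖ * (C * ‖a'‖) * C := by
        have : 0 ≤ ‖h‖ * (C * ‖a'‖) := by positivity
        nlinarith
    _ = _ := by ring

include hC1 hC in
-- The curve `exp (-sa) exp (s(a + h))` has derivative `exp (-sa) h exp (s(a + h))`, which is close
-- to `h`; integrate over `[0, 1]`.
theorem norm_exp_neg_mul_exp_sub_le {a h : A} (ha : ‖a‖ ≤ r) (hah : ‖a + h‖ ≤ r) :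
    ‖exp (-a) * exp (a + h) - 1 - h‖ ≤ C ^ 2 * (2 * ‖a‖ + ‖h‖) * ‖h‖ := by
  have hr : 0 ≤ r := (norm_nonneg _).trans ha
  have hd : ∀ s ∈ Icc (0 : ℝ) 1, HasDerivWithinAt
      (fun s : ℝ => exp (s • -a) * exp (s • (a + h)) - s • h)
      (exp (s • -a) * h * exp (s • (a + h)) - (1 : ℝ) • h) (Icc 0 1) s := fun s _ =>
    ((hasDerivAt_exp_neg_mul_exp a h s).sub ((hasDerivAt_id s).smul_const h)).hasDerivWithinAt
  have hb : ∀ s ∈ Icc (0 : ℝ) 1, ‖exp (s • -a) * h * exp (s • (a + h)) - (1 : ℝ) • h‖ ≤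
      C ^ 2 * (2 * ‖a‖ + ‖h‖) * ‖h‖ := fun s hs => by
    have h1 : ‖s • a‖ ≤ ‖a‖ := norm_smul_le_of_mem_Icc hs
    have h2 : ‖s • (a + h)‖ ≤ ‖a + h‖ := norm_smul_le_of_mem_Icc hs
    rw [smul_neg, one_smul]
    refine (norm_conj_sub_le hC1 hC (h1.trans ha) (h2.trans hah) hr).trans ?_
    have h3 := norm_add_le a h
    have h4 : ‖s • a‖ + ‖s • (a + h)‖ ≤ 2 * ‖a‖ + ‖h‖ := by linarith
    exact mul_le_mul_of_nonneg_right (mul_le_mul_of_nonneg_left h4 (by positivity)) (norm_nonneg _)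
  have := (convex_Icc (0 : ℝ) 1).norm_image_sub_le_of_norm_hasDerivWithin_le hd hb
    (left_mem_Icc.2 zero_le_one) (right_mem_Icc.2 zero_le_one)
  simp only [one_smul, zero_smul, exp_zero, mul_one, sub_zero, norm_one] at this
  rwa [sub_right_comm] at this

include hC in
-- In the derivative `exp (-sa) h exp (s(a + h))`, replacing the last factor by `exp (sa)` costs
-- only `O(‖h‖²)`, and the invariance of `Q` then removes the conjugation exactly. The error is thus
-- quadratic in `h`, without the term `‖a‖ ‖h‖` of the norm estimate.
theorem abs_functional_exp_neg_mul_exp_sub_le {a h : A} (ha : ‖a‖ ≤ r) (hah : ‖a + h‖ ≤ r)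
    (Q : A →L[ℝ] ℝ) (hQ : ∀ s : ℝ, Q (exp (-(s • a)) * h * exp (s • a)) = Q h) :
    |Q (exp (-a) * exp (a + h)) - Q 1 - Q h| ≤ ‖Q‖ * C ^ 2 * ‖h‖ ^ 2 := by
  have hd : ∀ s ∈ Icc (0 : ℝ) 1, HasDerivWithinAt
      (fun s : ℝ => Q (exp (s • -a) * exp (s • (a + h))) - s * Q h)
      (Q (exp (s • -a) * h * exp (s • (a + h))) - 1 * Q h) (Icc 0 1) s := fun s _ =>
    ((Q.hasFDerivAt.comp_hasDerivAt s (hasDerivAt_exp_neg_mul_exp a h s)).sub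
      ((hasDerivAt_id s).mul_const (Q h))).hasDerivWithinAt
  have hb : ∀ s ∈ Icc (0 : ℝ) 1, ‖Q (exp (s • -a) * h * exp (s • (a + h))) - 1 * Q h‖ ≤
      ‖Q‖ * C ^ 2 * ‖h‖ ^ 2 := fun s hs => by
    have h1 : ‖s • a‖ ≤ r := (norm_smul_le_of_mem_Icc hs).trans ha
    have h2 : ‖s • (a + h)‖ ≤ r := (norm_smul_le_of_mem_Icc hs).trans hah
    have e : Q (exp (s • -a) * h * exp (s • (a + h))) - 1 * Q h =
        Q (exp (-(s • a)) * h * (exp (s • (a + h)) - exp (s • a))) := by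
      rw [mul_sub, map_sub, hQ, smul_neg, one_mul]
    rw [e]
    have h3 := (hC (s • (a + h)) (s • a) h2 h1).2
    have h4 := (hC (-(s • a)) (s • a) (by simpa using h1) h1).1
    have h5 : ‖s • (a + h) - s • a‖ ≤ ‖h‖ := by
      rw [← smul_sub, add_sub_cancel_left]
      exact norm_smul_le_of_mem_Icc hs
    have hC0 : 0 ≤ C := (norm_nonneg _).trans h4
    calc _ ≤ ‖Q‖ * ‖exp (-(s • a)) * h * (exp (s • (a + h)) - exp (s • a))‖ := Q.le_opNorm _
      _ ≤ ‖Q‖ * (‖exp (-(s • a))‖ * ‖h‖ * ‖exp (s • (a + h)) - exp (s • a)‖) := by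
          gcongr
          exact (norm_mul_le _ _).trans
            (mul_le_mul_of_nonneg_right (norm_mul_le _ _) (norm_nonneg _))
      _ ≤ ‖Q‖ * (C * ‖h‖ * (C * ‖h‖)) := by
          gcongr
          exact h3.trans (by gcongr)
      _ = _ := by ring
  have := (convex_Icc (0 : ℝ) 1).norm_image_sub_le_of_norm_hasDerivWithin_le hd hb
    (left_mem_Icc.2 zero_le_one) (right_mem_Icc.2 zero_le_one)
  simp only [one_smul, zero_smul, exp_zero, mul_one, one_mul, zero_mul, sub_zero, norm_one] at this
  rwa [sub_right_comm, Real.norm_eq_abs] at this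

theorem exp_neg_smul_mul_exp_neg_smul (x : A) (s t : ℝ) :
    exp (-(s • x)) * exp (-(t • x)) = exp (-((s + t) • x)) := by
  let : NormedAlgebra ℚ A := NormedAlgebra.restrictScalars ℚ ℝ A
  rw [← exp_add_of_commute]
  · congr 1
    module
  · exact ((((Commute.refl x).smul_left s).smul_right t).neg_left).neg_right

theorem exp_smul_mul_exp_smul (x : A) (s t : ℝ) :
    exp (s • x) * exp (t • x) = exp ((s + t) • x) := by
  have := exp_neg_smul_mul_exp_neg_smul (-x) s t
  simpa using this

/-- First- and second-order comparison for the equation `exp x * exp (2y) * exp x = exp (2z)`. -/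
theorem exists_geodesic_estimates (A : Type*) [NormedRing A] [NormedAlgebra ℝ A]
    [CompleteSpace A] : ∃ δ₀ > 0, ∃ C > 0, ∀ x y z : A, ∀ δ ≤ δ₀, ‖x‖ ≤ δ → ‖y‖ ≤ δ → ‖z‖ ≤ δ →
      exp x * exp ((2 : ℝ) • y) * exp x = exp ((2 : ℝ) • z) →
      ‖(z - (2 : ℝ) • x) - (y - x)‖ ≤ C * δ * (‖z - (2 : ℝ) • x‖ + ‖y - x‖) ∧
      ∀ Q : A →L[ℝ] ℝ,
        (∀ s : ℝ, Q (exp (-(s • x)) * (z - (2 : ℝ) • x) * exp (s • x)) = Q (z - (2 : ℝ) • x)) →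
        (∀ s : ℝ, Q (exp (-(s • x)) * (y - x) * exp (s • x)) = Q (y - x)) →
        |Q (z - (2 : ℝ) • x) - Q (y - x)| ≤
          C * ‖Q‖ * (‖z - (2 : ℝ) • x‖ ^ 2 + ‖y - x‖ ^ 2) := by
  obtain ⟨r, hr, C, hC1, hC⟩ := exists_exp_bounds A
  -- The radius `r / 4` keeps `4x`, `2x`, `2y` and `2z` in the ball where the exponential bounds
  -- hold; `100` is merely generous.
  refine ⟨r / 4, by positivity, 100 * C ^ 4, by positivity, ?_⟩
  intro x y z δ hδ hx hy hz heq
  set w := z - (2 : ℝ) • x with hw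
  set b := y - x with hb
  have hδ0 : 0 ≤ δ := (norm_nonneg _).trans hx
  have hC2 : 1 ≤ C ^ 2 := one_le_pow₀ hC1
  have hC24 : C ^ 2 ≤ C ^ 4 := pow_le_pow_right₀ hC1 (by norm_num)
  have hn : ∀ (t : ℝ) (v : A), 0 ≤ t → ‖t • v‖ = t * ‖v‖ := fun t v ht => by
    rw [norm_smul, Real.norm_of_nonneg ht]
  have hwn : ‖w‖ ≤ 3 * δ := by
    have h1 := norm_sub_le z ((2 : ℝ) • x)
    rw [hn 2 x zero_le_two] at h1
    linarith
  have hbn : ‖b‖ ≤ 2 * δ := by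
    have h1 := norm_sub_le y x
    linarith
  have e1 : (4 : ℝ) • x + (2 : ℝ) • w = (2 : ℝ) • z := by rw [hw]; module
  have e2 : (2 : ℝ) • x + (2 : ℝ) • b = (2 : ℝ) • y := by rw [hb]; module
  have n1 : ‖(4 : ℝ) • x‖ ≤ r := by rw [hn 4 x (by norm_num)]; linarith
  have n2 : ‖(4 : ℝ) • x + (2 : ℝ) • w‖ ≤ r := by rw [e1, hn 2 z (by norm_num)]; linarith
  have n3 : ‖(2 : ℝ) • x‖ ≤ r := by rw [hn 2 x (by norm_num)]; linarith
  have n4 : ‖(2 : ℝ) • x + (2 : ℝ) • b‖ ≤ r := by rw [e2, hn 2 y (by norm_num)]; linarith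
  have nx : ‖x‖ ≤ r := by linarith
  -- Multiplying the equation on the left by `exp (-4x)` puts both sides in the form `exp (-a) exp
  -- (a + h)`, with `h = 2w` and `h = 2b`, up to conjugation by `exp x`.
  have key : exp (-((4 : ℝ) • x)) * exp ((4 : ℝ) • x + (2 : ℝ) • w) =
      exp (-x) * (exp (-((2 : ℝ) • x)) * exp ((2 : ℝ) • x + (2 : ℝ) • b)) * exp x := by
    rw [e1, e2, ← heq]
    have h1 : exp (-((4 : ℝ) • x)) * exp x = exp (-x) * exp (-((2 : ℝ) • x)) := by
      have h2 := exp_neg_smul_mul_exp_neg_smul x 4 (-1)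
      have h3 := exp_neg_smul_mul_exp_neg_smul x 1 2
      rw [one_smul] at h3
      rw [h3]
      rw [neg_smul, one_smul, neg_neg] at h2
      rw [h2]
      norm_num
    simp only [← mul_assoc]
    rw [h1]
  have hxinv : exp (-x) * exp x = 1 := exp_neg_mul_exp_self x
  have hcx := (hC x x nx nx).1
  have hcx' := (hC (-x) x (by simpa using nx) nx).1
  have nw := hn 2 w zero_le_two
  have nb := hn 2 b zero_le_two
  have n4x := hn 4 x (by norm_num)
  have n2x := hn 2 x zero_le_two
  have hw0 := norm_nonneg w
  have hb0 := norm_nonneg b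
  constructor
  · have h1 := norm_exp_neg_mul_exp_sub_le hC1 hC n1 n2
    have h2 := norm_exp_neg_mul_exp_sub_le hC1 hC n3 n4
    have h3 := norm_conj_sub_le hC1 hC (h := (2 : ℝ) • b) nx nx hr.le
    set ε1 := exp (-((4 : ℝ) • x)) * exp ((4 : ℝ) • x + (2 : ℝ) • w) - 1 - (2 : ℝ) • w with hε1
    set ε2 := exp (-((2 : ℝ) • x)) * exp ((2 : ℝ) • x + (2 : ℝ) • b) - 1 - (2 : ℝ) • b with hε2
    have e3 : (2 : ℝ) • (w - b) =
        (exp (-x) * ((2 : ℝ) • b) * exp x - (2 : ℝ) • b) + exp (-x) * ε2 * exp x - ε1 := by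
      have e4 : exp (-x) * ε2 * exp x = exp (-((4 : ℝ) • x)) * exp ((4 : ℝ) • x + (2 : ℝ) • w) -
          1 - exp (-x) * ((2 : ℝ) • b) * exp x := by
        rw [key, hε2, mul_sub, mul_sub, sub_mul, sub_mul, mul_one, hxinv]
      rw [e4, hε1, smul_sub]
      abel
    have h4 : ‖exp (-x) * ε2 * exp x‖ ≤ C * ‖ε2‖ * C :=
      (norm_mul_le _ _).trans (mul_le_mul ((norm_mul_le _ _).trans
        (mul_le_mul_of_nonneg_right hcx' (norm_nonneg _))) hcx (norm_nonneg _) (by positivity))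
    have h5 : 2 * ‖w - b‖ ≤ ‖exp (-x) * ((2 : ℝ) • b) * exp x - (2 : ℝ) • b‖ +
        ‖exp (-x) * ε2 * exp x‖ + ‖ε1‖ := by
      rw [← hn 2 _ zero_le_two, e3]
      exact (norm_sub_le _ _).trans (add_le_add_left (norm_add_le _ _) _)
    rw [nw, n4x] at h1
    rw [nb, n2x] at h2
    rw [nb] at h3
    have h1' : ‖ε1‖ ≤ C ^ 4 * (28 * δ) * ‖w‖ := by
      calc ‖ε1‖ ≤ C ^ 2 * (2 * (4 * ‖x‖) + 2 * ‖w‖) * (2 * ‖w‖) := h1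
        _ ≤ C ^ 4 * (2 * (4 * δ) + 2 * (3 * δ)) * (2 * ‖w‖) := by gcongr
        _ = _ := by ring
    have h2' : C * ‖ε2‖ * C ≤ C ^ 4 * (16 * δ) * ‖b‖ := by
      calc C * ‖ε2‖ * C ≤ C * (C ^ 2 * (2 * (2 * δ) + 2 * (2 * δ)) * (2 * ‖b‖)) * C := by
            gcongr
            exact h2.trans (by gcongr)
        _ = _ := by ring
    have h3' : ‖exp (-x) * ((2 : ℝ) • b) * exp x - (2 : ℝ) • b‖ ≤ C ^ 4 * (4 * δ) * ‖b‖ := by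
      calc _ ≤ C ^ 2 * (‖x‖ + ‖x‖) * (2 * ‖b‖) := h3
        _ ≤ C ^ 4 * (δ + δ) * (2 * ‖b‖) := by gcongr
        _ = _ := by ring
    have p1 : 0 ≤ C ^ 4 * δ * ‖w‖ := by positivity
    have p2 : 0 ≤ C ^ 4 * δ * ‖b‖ := by positivity
    linarith
  · intro Q hQw hQb
    have h1 := abs_functional_exp_neg_mul_exp_sub_le hC n1 n2 Q (fun s => by
      have := hQw (s * 4)
      rw [smul_smul, mul_smul_comm, smul_mul_assoc, map_smul, map_smul, this])
    -- The outer conjugation in `key` is absorbed into the functional; `Q'` has the same value as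
    -- `Q` on `b` and on `1`.
    set Q' : A →L[ℝ] ℝ := Q.comp (ContinuousLinearMap.mulLeftRight ℝ A (exp (-x)) (exp x)) with hQ'
    have hQ'a : ∀ m, Q' m = Q (exp (-x) * m * exp x) := fun m => by simp [hQ']
    have h2 := abs_functional_exp_neg_mul_exp_sub_le hC n3 n4 Q' (fun s => by
      have h3 := hQb (1 + s * 2)
      have h4 := hQb 1
      rw [one_smul] at h4
      rw [smul_smul, mul_smul_comm, smul_mul_assoc, map_smul, map_smul, hQ'a, hQ'a, h4]
      rw [← exp_neg_smul_mul_exp_neg_smul, add_comm 1, ← exp_smul_mul_exp_smul, one_smul] at h3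
      rw [← h3]
      simp only [mul_assoc])
    have hQ'n : ‖Q'‖ ≤ ‖Q‖ * C ^ 2 := by
      refine (Q.opNorm_comp_le _).trans (mul_le_mul_of_nonneg_left ?_ (norm_nonneg _))
      refine (ContinuousLinearMap.opNorm_mulLeftRight_apply_apply_le ℝ A _ _).trans ?_
      rw [sq]
      exact mul_le_mul hcx' hcx (norm_nonneg _) (by positivity)
    have h4 := hQb 1
    rw [one_smul] at h4
    have h5 : Q' ((2 : ℝ) • b) = 2 * Q b := by
      rw [map_smul, hQ'a, h4, smul_eq_mul]
    have h6 : Q' 1 = Q 1 := by rw [hQ'a, mul_one, hxinv]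
    rw [h5, h6, hQ'a, ← key, nb] at h2
    rw [map_smul, smul_eq_mul, nw] at h1
    have h7 : ‖Q'‖ * C ^ 2 * (2 * ‖b‖) ^ 2 ≤ ‖Q‖ * C ^ 4 * 4 * ‖b‖ ^ 2 := by
      calc _ ≤ (‖Q‖ * C ^ 2) * C ^ 2 * (2 * ‖b‖) ^ 2 := by gcongr
        _ = _ := by ring
    have h8 : ‖Q‖ * C ^ 2 * (2 * ‖w‖) ^ 2 ≤ ‖Q‖ * C ^ 4 * 4 * ‖w‖ ^ 2 := by
      calc _ ≤ ‖Q‖ * C ^ 4 * (2 * ‖w‖) ^ 2 := by gcongr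
        _ = _ := by ring
    have p1 : 0 ≤ ‖Q‖ * C ^ 4 * ‖w‖ ^ 2 := by positivity
    have p2 : 0 ≤ ‖Q‖ * C ^ 4 * ‖b‖ ^ 2 := by positivity
    rw [abs_le] at h1 h2 ⊢
    obtain ⟨h1, h1'⟩ := h1
    obtain ⟨h2, h2'⟩ := h2
    constructor <;> linarith
end BanachAlgebra

end LieKP

namespace LieKP

open scoped NNReal
open Filter Topology Set Metric NormedSpace

set_option linter.unusedSectionVars false

/-! ### The corner-cutting inequality. -/

section LieEstimate

variable {E : Type*} [NormedAddCommGroup E] [NormedSpace ℝ E] [CompleteSpace E]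

theorem hasDerivAt_exp_neg_smul_apply (T : E →L[ℝ] E) (U : E) (s : ℝ) :
    HasDerivAt (fun s : ℝ => exp (-(s • T)) U) (-T (exp (-(s • T)) U)) s := by
  have h := (hasDerivAt_exp_smul_const' (𝕂 := ℝ) (-T) s).clm_apply (hasDerivAt_const s U)
  simpa using h

/-- By the Jacobi identity `had`, the curve `exp (s ad X) · ad (exp (-s ad X) U) · exp (-s ad X)`
has zero derivative. -/
theorem exp_conj_ad {ad : E →L[ℝ] E →L[ℝ] E}
    (had : ∀ X Y, ad (ad X Y) = ad X * ad Y - ad Y * ad X) (X U : E) (s : ℝ) :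
    exp (-(s • ad X)) * ad U * exp (s • ad X) = ad (exp (-(s • ad X)) U) := by
  set x := ad X with hx
  have hd : ∀ s : ℝ, HasDerivAt
      (fun s : ℝ => exp (s • x) * ad (exp (-(s • x)) U) * exp (s • -x)) 0 s := by
    intro s
    have h1 := ad.hasFDerivAt.comp_hasDerivAt s (hasDerivAt_exp_neg_smul_apply x U s)
    have h2 := ((hasDerivAt_exp_smul_const (𝕂 := ℝ) x s).mul h1).mul
      (hasDerivAt_exp_smul_const' (𝕂 := ℝ) (-x) s)
    refine h2.congr_deriv ?_
    rw [map_neg, hx, had]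
    simp only [Function.comp, Pi.mul_apply]
    noncomm_ring
  have h := is_const_of_deriv_eq_zero (fun t => (hd t).differentiableAt)
    (fun t => (hd t).deriv) s 0
  simp only [zero_smul, neg_zero, exp_zero, mul_one, one_mul, smul_neg,
    one_apply_eq_self] at h
  have h1 : exp (-(s • x)) * exp (s • x) = 1 := exp_neg_mul_exp_self _
  rw [← h]
  calc _ = (exp (-(s • x)) * exp (s • x)) * ad (exp (-(s • x)) U) *
        (exp (-(s • x)) * exp (s • x)) := by simp only [mul_assoc]
    _ = _ := by rw [h1, one_mul, mul_one]

theorem functional_exp_apply {T : E →L[ℝ] E} {l : E →L[ℝ] ℝ} (h : ∀ V, l (T V) = 0) (U : E)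
    (s : ℝ) : l (exp (-(s • T)) U) = l U := by
  have hd : ∀ s : ℝ, HasDerivAt (fun s : ℝ => l (exp (-(s • T)) U)) 0 s := fun s => by
    refine (l.hasFDerivAt.comp_hasDerivAt s (hasDerivAt_exp_neg_smul_apply T U s)).congr_deriv ?_
    rw [map_neg, h, neg_zero]
  have h := is_const_of_deriv_eq_zero (fun t => (hd t).differentiableAt)
    (fun t => (hd t).deriv) s 0
  simpa using h

/-- A broken geodesic with small sides can be shortened by cutting its corner. -/
theorem exists_corner_cutting {ad : E →L[ℝ] E →L[ℝ] E}
    (had : ∀ X Y, ad (ad X Y) = ad X * ad Y - ad Y * ad X)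
    {L : (E →L[ℝ] E) →L[ℝ] E} (hL : ∀ U, L (ad U) = U)
    {B : E →L[ℝ] E →L[ℝ] ℝ} (hB : ∀ U V, B U V = B V U) {c : ℝ} (hc : 0 < c)
    (hBc : ∀ U, c * ‖U‖ ^ 2 ≤ B U U)
    {𝔭 : Submodule ℝ E} {P : E →L[ℝ] E} (hP : ∀ U ∈ 𝔭, P U = U)
    (hskew : ∀ X ∈ 𝔭, ∀ V, B X (P (ad X V)) = 0) :
    ∃ δ > 0, ∀ X ∈ 𝔭, ∀ Y ∈ 𝔭, ∀ Z ∈ 𝔭, ‖X‖ ≤ δ → ‖Y‖ ≤ δ → ‖Z‖ ≤ δ →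
      exp (ad X) * exp ((2 : ℝ) • ad Y) * exp (ad X) = exp ((2 : ℝ) • ad Z) → X ≠ Y →
      B Z Z < 2 * (B X X + B Y Y) := by
  obtain ⟨δ₀, hδ₀, C, hC, hest⟩ := exists_geodesic_estimates (E →L[ℝ] E)
  set a := ‖ad‖ + 1 with ha
  have ha1 : 1 ≤ a := by have := norm_nonneg ad; linarith
  have hadn : ∀ U, ‖ad U‖ ≤ a * ‖U‖ := fun U => (ad.le_opNorm U).trans
    (mul_le_mul_of_nonneg_right (by linarith) (norm_nonneg _))
  set C3 := ‖L‖ * (C * a * a) with hC3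
  have hC30 : 0 ≤ C3 := by positivity
  set C5 := C * (‖B‖ * ‖P‖ * ‖L‖) * (5 * a ^ 2) with hC5
  have hC50 : 0 ≤ C5 := by positivity
  -- `C3` controls `W - V`, `C5` controls `B X W - B X V`, and `C6` is the total coefficient of `δ
  -- ‖V‖²` that must stay below the coercivity constant `c`.
  set C6 := 4 * C5 + 9 * ‖B‖ * C3 with hC6
  have hC60 : 0 ≤ C6 := by positivity
  obtain ⟨δ, hδ, hδ1, hδ2, hδ3⟩ : ∃ δ : ℝ, 0 < δ ∧ a * δ ≤ δ₀ ∧ C3 * δ ≤ 1 / 3 ∧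
      C6 * δ < c := by
    refine ⟨min (δ₀ / a) (min (1 / (3 * (C3 + 1))) (c / (C6 + 1))), by positivity, ?_, ?_, ?_⟩
    · calc a * _ ≤ a * (δ₀ / a) := by gcongr; exact min_le_left _ _
        _ = δ₀ := by field_simp
    · calc C3 * _ ≤ (C3 + 1) * (1 / (3 * (C3 + 1))) := by
            gcongr
            · linarith
            · exact (min_le_right _ _).trans (min_le_left _ _)
        _ = 1 / 3 := by field_simp
    · calc C6 * _ < (C6 + 1) * (c / (C6 + 1)) := by
            refine mul_lt_mul (by linarith) ((min_le_right _ _).trans (min_le_right _ _))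
              (by positivity) (by positivity)
        _ = c := by field_simp
  refine ⟨δ, hδ, ?_⟩
  intro X hX Y hY Z hZ hXδ hYδ hZδ heq hne
  have hn : ∀ U : E, ‖U‖ ≤ δ → ‖ad U‖ ≤ a * δ := fun U hU => (hadn U).trans (by gcongr)
  obtain ⟨h1, h2⟩ := hest (ad X) (ad Y) (ad Z) (a * δ) hδ1 (hn X hXδ) (hn Y hYδ) (hn Z hZδ) heq
  have hW𝔭 : Z - (2 : ℝ) • X ∈ 𝔭 := 𝔭.sub_mem hZ (𝔭.smul_mem _ hX)
  have hV𝔭 : Y - X ∈ 𝔭 := 𝔭.sub_mem hY hX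
  have ew : ad Z - (2 : ℝ) • ad X = ad (Z - (2 : ℝ) • X) := by simp
  have ev : ad Y - ad X = ad (Y - X) := by simp
  rw [ew, ev] at h1 h2
  set W := Z - (2 : ℝ) • X with hW
  set V := Y - X with hV
  have hV0 : 0 < ‖V‖ := norm_pos_iff.2 (sub_ne_zero.2 hne.symm)
  have hW0 := norm_nonneg W
  have h3 : ‖W - V‖ ≤ C3 * δ * (‖W‖ + ‖V‖) := by
    have e : W - V = L (ad W - ad V) := by rw [map_sub, hL, hL]
    rw [e]
    calc _ ≤ ‖L‖ * ‖ad W - ad V‖ := L.le_opNorm _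
      _ ≤ ‖L‖ * (C * (a * δ) * (a * ‖W‖ + a * ‖V‖)) := by
          gcongr
          exact h1.trans (by gcongr <;> exact hadn _)
      _ = _ := by rw [hC3]; ring
  have h4 : ‖W‖ ≤ 2 * ‖V‖ := by
    have h5 := norm_le_norm_sub_add W V
    have h6 : C3 * δ * (‖W‖ + ‖V‖) ≤ 1 / 3 * (‖W‖ + ‖V‖) := by gcongr
    linarith
  have h5 : ‖W - V‖ ≤ 3 * C3 * δ * ‖V‖ := by
    refine h3.trans ?_
    have : C3 * δ * (‖W‖ + ‖V‖) ≤ C3 * δ * (3 * ‖V‖) := by gcongr; linarith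
    linarith
  -- On the image of `ad` this functional is `ad U ↦ B X (P U)`; `hskew` makes it invariant under
  -- conjugation by `exp (s ad X)` there.
  set Q : (E →L[ℝ] E) →L[ℝ] ℝ := ((B X).comp P).comp L with hQ
  have hQad : ∀ U, Q (ad U) = B X (P U) := fun U => by simp [hQ, hL]
  have hQinv : ∀ U, ∀ s : ℝ, Q (exp (-(s • ad X)) * ad U * exp (s • ad X)) = Q (ad U) := by
    intro U s
    rw [exp_conj_ad had, hQad, hQad]
    exact functional_exp_apply (l := (B X).comp P) (fun V => hskew X hX V) U s
  have h6 := h2 Q (hQinv W) (hQinv V)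
  rw [hQad, hQad, hP W hW𝔭, hP V hV𝔭] at h6
  have hQn : ‖Q‖ ≤ ‖B‖ * ‖P‖ * ‖L‖ * δ := by
    calc ‖Q‖ ≤ ‖B X‖ * ‖P‖ * ‖L‖ := (ContinuousLinearMap.opNorm_comp_le _ _).trans
          (mul_le_mul_of_nonneg_right (ContinuousLinearMap.opNorm_comp_le _ _) (norm_nonneg _))
      _ ≤ (‖B‖ * δ) * ‖P‖ * ‖L‖ := by
          gcongr
          exact (B.le_opNorm X).trans (by gcongr)
      _ = _ := by ring
  have h7 : |B X W - B X V| ≤ C5 * δ * ‖V‖ ^ 2 := by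
    calc _ ≤ _ := h6
      _ ≤ C * (‖B‖ * ‖P‖ * ‖L‖ * δ) * ((a * (2 * ‖V‖)) ^ 2 + (a * ‖V‖) ^ 2) := by
          gcongr
          · exact (hadn W).trans (by gcongr)
          · exact hadn V
      _ = _ := by rw [hC5]; ring
  have hBn : ∀ U V, |B U V| ≤ ‖B‖ * ‖U‖ * ‖V‖ := fun U V => B.le_opNorm₂ U V
  have h8 : |B W W - B V V| ≤ 9 * ‖B‖ * C3 * δ * ‖V‖ ^ 2 := by
    have e : B W W - B V V = B (W - V) W + B V (W - V) := by simp
    rw [e]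
    calc _ ≤ |B (W - V) W| + |B V (W - V)| := abs_add_le _ _
      _ ≤ ‖B‖ * (3 * C3 * δ * ‖V‖) * (2 * ‖V‖) + ‖B‖ * ‖V‖ * (3 * C3 * δ * ‖V‖) := by
          refine add_le_add ((hBn _ _).trans ?_) ((hBn _ _).trans ?_) <;> gcongr
      _ = _ := by ring
  have eZ : Z = (2 : ℝ) • X + W := by rw [hW]; module
  have eY : Y = X + V := by rw [hV]; module
  have e1 : B Z Z = 4 * B X X + 4 * B X W + B W W := by
    rw [eZ]
    simp [hB W X]
    ring
  have e2 : B Y Y = B X X + 2 * B X V + B V V := by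
    rw [eY]
    simp [hB V X]
    ring
  have h9 := hBc V
  have h10 : C6 * δ * ‖V‖ ^ 2 < c * ‖V‖ ^ 2 := by gcongr
  have h11 : C6 * δ * ‖V‖ ^ 2 = 4 * (C5 * δ * ‖V‖ ^ 2) + 9 * ‖B‖ * C3 * δ * ‖V‖ ^ 2 := by
    rw [hC6]; ring
  -- The terms `4 B X X` cancel, and `-B V V ≤ -c ‖V‖²` outweighs the two errors.
  rw [e1, e2]
  have h7' := (abs_le.1 h7).2
  have h8' := (abs_le.1 h8).2
  linarith

end LieEstimate

end LieKP

namespace LieKP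

open scoped NNReal
open Filter Topology Set Metric NormedSpace

set_option linter.unusedSectionVars false

/-! ### Invariant inner products. -/

section Average

open MeasureTheory in
/-- A representation of a compact group on a finite-dimensional real vector space has an invariant
inner product. -/
theorem exists_invariant_inner {E : Type*} [NormedAddCommGroup E] [NormedSpace ℝ E]
    [FiniteDimensional ℝ E] {H : Type*} [Group H] [TopologicalSpace H] [IsTopologicalGroup H]
    [CompactSpace H] {ρ : H → E →L[ℝ] E} (hρ : Continuous ρ)
    (hmul : ∀ g h, ρ (g * h) = (ρ g).comp (ρ h)) (hone : ρ 1 = 1) :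
    ∃ B : E →L[ℝ] E →L[ℝ] ℝ, (∀ U V, B U V = B V U) ∧
      (∃ c > 0, ∀ U, c * ‖U‖ ^ 2 ≤ B U U) ∧ ∀ h U V, B (ρ h U) (ρ h V) = B U V := by
  borelize H
  -- The integrand uses `ρ k⁻¹`, so that left invariance of `μ` yields invariance of the averaged
  -- form.
  let μ : Measure H := Measure.haar
  set J := toEuclidean (E := E) with hJ
  have hcU : ∀ U, Continuous fun k : H => J (ρ k⁻¹ U) := fun U =>
    J.continuous.comp ((hρ.comp continuous_inv).clm_apply continuous_const)
  have hc : ∀ U V, Continuous fun k : H => inner ℝ (J (ρ k⁻¹ U)) (J (ρ k⁻¹ V)) := fun U V =>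
    (hcU U).inner (hcU V)
  have hi : ∀ U V, Integrable (fun k : H => inner ℝ (J (ρ k⁻¹ U)) (J (ρ k⁻¹ V))) μ := fun U V =>
    (hc U V).integrable_of_hasCompactSupport (HasCompactSupport.of_compactSpace _)
  let B₀ : E →ₗ[ℝ] E →ₗ[ℝ] ℝ := LinearMap.mk₂ ℝ
    (fun U V => ∫ k, inner ℝ (J (ρ k⁻¹ U)) (J (ρ k⁻¹ V)) ∂μ)
    (fun U U' V => by
      simp only [map_add, inner_add_left]
      exact integral_add (hi _ _) (hi _ _))
    (fun a U V => by
      simp only [map_smul, inner_smul_left]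
      exact integral_const_mul _ _)
    (fun U V V' => by
      simp only [map_add, inner_add_right]
      exact integral_add (hi _ _) (hi _ _))
    (fun a U V => by
      simp only [map_smul, inner_smul_right]
      exact integral_const_mul _ _)
  let B : E →L[ℝ] E →L[ℝ] ℝ :=
    LinearMap.toContinuousLinearMap (LinearMap.toContinuousLinearMap.toLinearMap ∘ₗ B₀)
  have hB : ∀ U V, B U V = ∫ k, inner ℝ (J (ρ k⁻¹ U)) (J (ρ k⁻¹ V)) ∂μ := fun U V => rfl
  have hpos : ∀ U, U ≠ 0 → 0 < B U U := by
    intro U hU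
    rw [hB]
    refine (hc U U).integral_pos_of_hasCompactSupport_nonneg_nonzero
      (HasCompactSupport.of_compactSpace _) (fun k => real_inner_self_nonneg) (x := 1) ?_
    simpa [hone] using hU
  refine ⟨B, fun U V => ?_, ?_, fun h U V => ?_⟩
  · simp only [hB, real_inner_comm]
  · have hcont : Continuous fun U => B U U := B.continuous.clm_apply continuous_id
    obtain hE | hE := subsingleton_or_nontrivial E
    · exact ⟨1, one_pos, fun U => by simp [Subsingleton.elim U 0]⟩
    · obtain ⟨V, hV, hmin⟩ := (isCompact_sphere (0 : E) 1).exists_isMinOn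
        (NormedSpace.sphere_nonempty.2 zero_le_one) hcont.continuousOn
      have hV1 : ‖V‖ = 1 := by simpa using hV
      refine ⟨B V V, hpos V (by rw [← norm_ne_zero_iff, hV1]; exact one_ne_zero), fun U => ?_⟩
      obtain rfl | hU := eq_or_ne U 0
      · simp
      · have hU' : ‖U‖ ≠ 0 := norm_ne_zero_iff.2 hU
        have h := hmin (a := ‖U‖⁻¹ • U) (by simp [norm_smul, hU'])
        simp only [mem_ofPred_eq, map_smul, smul_apply, smul_eq_mul] at h
        calc B V V * ‖U‖ ^ 2 ≤ (‖U‖⁻¹ * (‖U‖⁻¹ * B U U)) * ‖U‖ ^ 2 := by gcongr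
          _ = B U U := by field_simp
  · have h1 := integral_mul_left_eq_self (μ := μ)
      (fun k : H => inner ℝ (J (ρ k⁻¹ U)) (J (ρ k⁻¹ V))) h⁻¹
    rw [hB, hB, ← h1]
    simp only [mul_inv_rev, inv_inv, hmul, ContinuousLinearMap.comp_apply]

end Average

/-! ### Finite centre and injectivity of the adjoint representation. -/

section Centre

variable {E : Type*} [NormedAddCommGroup E] [NormedSpace ℝ E] [CompleteSpace E]
  {G : Type*} [TopologicalSpace G] [T2Space G] [ChartedSpace E G] [Group G]
  [LieGroup 𝓘(ℝ, E) ∞ G]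

/-- The Jacobi identity for the bracket in the chart. -/
theorem chartAd_chartAd (X Y : E) : chartAd (E := E) G (chartAd (E := E) G X Y) =
    chartAd (E := E) G X * chartAd (E := E) G Y - chartAd (E := E) G Y * chartAd (E := E) G X := by
  have h : ∀ X Y V : GroupLieAlgebra 𝓘(ℝ, E) G, chartAd (E := E) G (chartAd (E := E) G X Y) V =
      chartAd (E := E) G X (chartAd (E := E) G Y V) -
        chartAd (E := E) G Y (chartAd (E := E) G X V) := fun X Y V => by
    have h1 := lie_lie X Y V
    have h2 := lie_eq_chartAd X Y
    have h3 := lie_eq_chartAd (E := E) (G := G) ⁅X, Y⁆ V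
    have h4 := lie_eq_chartAd (E := E) (G := G) X ⁅Y, V⁆
    have h5 := lie_eq_chartAd (E := E) (G := G) Y ⁅X, V⁆
    rw [h2] at h3
    rw [lie_eq_chartAd Y V] at h4
    rw [lie_eq_chartAd X V] at h5
    exact h3.symm.trans ((congrArg (fun Z => ⁅Z, V⁆) h2.symm).trans
      (h1.trans (congrArg₂ (fun a b : GroupLieAlgebra 𝓘(ℝ, E) G => a - b)
        ((congrArg (fun Z => ⁅X, Z⁆) (lie_eq_chartAd Y V)).trans h4)
        ((congrArg (fun Z => ⁅Y, Z⁆) (lie_eq_chartAd X V)).trans h5))))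
  ext V
  exact h X Y V

/-- A connected Lie group is generated by any subset whose span under products contains a
neighbourhood of the identity. -/
theorem subgroup_eq_top_of_mem_nhds [ConnectedSpace G] [IsTopologicalGroup G] {H : Subgroup G}
    (h : (H : Set G) ∈ 𝓝 1) : H = ⊤ := by
  have ho : IsOpen (H : Set G) := H.isOpen_of_mem_nhds h
  have hcl : IsClopen (H : Set G) := ⟨H.isClosed_of_isOpen ho, ho⟩
  rw [← Subgroup.coe_eq_univ]
  exact hcl.eq_univ ⟨1, H.one_mem⟩

/-- The adjoint representation of a Lie algebra of a connected group with finite centre is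
injective. -/
theorem chartAd_injective [ConnectedSpace G] (hZ : Finite (Subgroup.center G)) :
    Function.Injective (chartAd (E := E) G) := by
  have : IsTopologicalGroup G := topologicalGroup_of_lieGroup 𝓘(ℝ, E) ∞
  rw [injective_iff_map_eq_zero]
  intro X hX
  have hAd : ∀ t : ℝ, Ad (E := E) (expE (t • X) : G) = 1 := fun t => by
    rw [Ad_expE, map_smul, hX, smul_zero, exp_zero]
  -- As `Ad (expE (t • X)) = 1`, this element commutes with every exponential, and exponentials fill
  -- a neighbourhood of `1` in the connected group `G`. The curve then lies in a finite set, hence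
  -- is constant.
  have hcen : ∀ t : ℝ, (expE (t • X) : G) ∈ Subgroup.center G := fun t => by
    have htop : Subgroup.centralizer {(expE (t • X) : G)} = ⊤ := by
      refine subgroup_eq_top_of_mem_nhds ?_
      refine mem_of_superset (image_expE_mul_expE_mem_nhds (P := (1 : E →L[ℝ] E)) (Q := 0)
        (add_zero _) univ_mem) ?_
      rintro _ ⟨U, -, rfl⟩
      have h := expE_conj (expE (t • X) : G) U
      rw [hAd] at h
      have h2 : (expE (t • X) : G) * expE U = expE U * expE (t • X) :=
        mul_inv_eq_iff_eq_mul.1 (by simpa using h)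
      simpa [Subgroup.mem_centralizer_singleton_iff] using h2.symm
    rw [Subgroup.mem_center_iff]
    intro g
    have : g ∈ Subgroup.centralizer {(expE (t • X) : G)} := htop ▸ Subgroup.mem_top g
    exact Subgroup.mem_centralizer_singleton_iff.1 this
  have hfin : (Subgroup.center G : Set G).Finite := Set.toFinite _
  have hconn : IsPreconnected (Set.range fun t : ℝ => (expE (t • X) : G)) :=
    isPreconnected_range (continuous_expE.comp (continuous_id.smul continuous_const))
  have hsub : (Set.range fun t : ℝ => (expE (t • X) : G)).Subsingleton :=
    Set.not_nontrivial_iff.1 fun hn =>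
      hconn.infinite_of_nontrivial hn (hfin.subset (by rintro _ ⟨t, rfl⟩; exact hcen t))
  refine eq_zero_of_expE_smul_eq_one (G := G) fun t => ?_
  have := hsub ⟨t, rfl⟩ ⟨0, rfl⟩
  simpa using this

end Centre

end LieKP

namespace LieKP

open scoped NNReal
open Filter Topology Set Metric NormedSpace

set_option linter.unusedSectionVars false

/-! ### The involution and the invariant form. -/

section Symmetric

variable {E : Type*} [NormedAddCommGroup E] [NormedSpace ℝ E]
  {G : Type*} [TopologicalSpace G] [T2Space G] [ChartedSpace E G] [Group G]
  [LieGroup 𝓘(ℝ, E) ∞ G]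

/-- A compact subgroup `K` and an involutive automorphism `θ` of the Lie algebra of `G` commuting
with the adjoint action of `K`, such that `K` contains the exponentials of the fixed points of
`θ`. -/
structure IsCompactSymmetric [CompleteSpace E] (K : Subgroup G) (θ : E →L[ℝ] E) : Prop where
  isCompact : IsCompact (K : Set G)
  involutive : ∀ U, θ (θ U) = U
  map_chartAd : ∀ X Y, θ (chartAd (E := E) G X Y) = chartAd (E := E) G (θ X) (θ Y)
  Ad_apply : ∀ k ∈ K, ∀ U, Ad (E := E) k (θ U) = θ (Ad k U)
  expE_mem : ∀ X, θ X = X → (expE X : G) ∈ K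

theorem expE_neg [CompleteSpace E] (X : E) : (expE (-X) : G) = (expE X)⁻¹ := by
  have h := expE_add_smul (G := G) X 1 (-1)
  rw [eq_inv_iff_mul_eq_one]
  have h2 := expE_add_smul (G := G) X (-1) 1
  simpa using h2.symm

theorem exp_two_smul {A : Type*} [NormedRing A] [NormedAlgebra ℝ A] [CompleteSpace A] (x : A) :
    exp ((2 : ℝ) • x) = exp x * exp x := by
  let : NormedAlgebra ℚ A := NormedAlgebra.restrictScalars ℚ ℝ A
  rw [two_smul, exp_add_of_commute (Commute.refl x)]

theorem chartAd_swap [CompleteSpace E] (X Y : E) :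
    chartAd (E := E) G X Y = -chartAd (E := E) G Y X := by
  have h : ∀ X Y : GroupLieAlgebra 𝓘(ℝ, E) G,
      chartAd (E := E) G X Y = -chartAd (E := E) G Y X := fun X Y =>
    (lie_eq_chartAd X Y).symm.trans ((lie_skew X Y).symm.trans (congrArg (fun Z => -Z)
      (lie_eq_chartAd Y X)))
  exact h X Y

theorem mul_exp_mul_of_mul_self {A : Type*} [NormedRing A] [NormedAlgebra ℝ A] [CompleteSpace A]
    {a : A} (ha : a * a = 1) (x : A) : a * exp x * a = exp (a * x * a) := by
  let : NormedAlgebra ℚ A := NormedAlgebra.restrictScalars ℚ ℝ A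
  exact (exp_units_conj (⟨a, a, ha, ha⟩ : Aˣ) x).symm

variable [FiniteDimensional ℝ E] [CompleteSpace E]

/-- An inner product which is invariant under `Ad (exp (t W))` makes `ad W` skew. -/
theorem inner_chartAd_skew {B : E →L[ℝ] E →L[ℝ] ℝ} {W : E}
    (h : ∀ (t : ℝ) (U V : E), B (Ad (expE (t • W) : G) U) (Ad (expE (t • W) : G) V) = B U V)
    (U V : E) : B (chartAd (E := E) G W U) V + B U (chartAd (E := E) G W V) = 0 := by
  set T := chartAd (E := E) G W with hT
  have hd : ∀ U, HasDerivAt (fun t : ℝ => exp (t • T) U) (T U) 0 := fun U => by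
    have := (hasDerivAt_exp_smul_const (𝕂 := ℝ) T 0).clm_apply (hasDerivAt_const (0 : ℝ) U)
    simpa using this
  have h1 := (B.hasFDerivAt.comp_hasDerivAt (0 : ℝ) (hd U)).clm_apply (hd V)
  have h2 : (fun t : ℝ => B (exp (t • T) U) (exp (t • T) V)) = fun _ => B U V := by
    funext t
    have := h t U V
    rwa [Ad_expE, map_smul] at this
  have h3 := h1.unique (f := fun t : ℝ => B (exp (t • T) U) (exp (t • T) V))
    (h2 ▸ hasDerivAt_const (0 : ℝ) (B U V))
  simpa using h3

/-- The `(-1)`-eigenspace of a linear map. -/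
def antiFixed (θ : E →L[ℝ] E) : Submodule ℝ E := LinearMap.ker ((θ + 1 : E →L[ℝ] E) : E →ₗ[ℝ] E)

theorem mem_antiFixed {θ : E →L[ℝ] E} {X : E} : X ∈ antiFixed θ ↔ θ X = -X := by
  simp [antiFixed, eq_neg_iff_add_eq_zero]

theorem IsCompactSymmetric.Ad_mem {K : Subgroup G} {θ : E →L[ℝ] E} (h : IsCompactSymmetric K θ)
    {k : G} (hk : k ∈ K) {X : E} (hX : X ∈ antiFixed θ) : Ad k X ∈ antiFixed θ := by
  rw [mem_antiFixed] at *
  rw [← h.Ad_apply k hk, hX, map_neg]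

theorem IsCompactSymmetric.mul_Ad_expE_mul {K : Subgroup G} {θ : E →L[ℝ] E}
    (h : IsCompactSymmetric K θ) {X : E} (hX : X ∈ antiFixed θ) :
    θ * Ad (expE X : G) * θ = Ad (expE (-X) : G) := by
  have hθ : θ * θ = 1 := by ext U; exact h.involutive U
  rw [Ad_expE, Ad_expE, mul_exp_mul_of_mul_self hθ]
  congr 1
  ext U
  change θ (chartAd (E := E) G X (θ U)) = _
  rw [h.map_chartAd, h.involutive, mem_antiFixed.1 hX]

/-- With `x, y, z, κ` the images under `Ad`, `xy = zκ`. Conjugation by `θ` inverts `x, y, z` and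
fixes `κ`, so `x⁻¹y⁻¹ = z⁻¹κ`, that is `κyx = z`. Multiplying, `xy²x = z²`, and `κ` is gone. -/
theorem IsCompactSymmetric.exp_eq_of_expE_mul {K : Subgroup G} {θ : E →L[ℝ] E}
    (h : IsCompactSymmetric K θ) {X Y Z : E} (hX : X ∈ antiFixed θ) (hY : Y ∈ antiFixed θ)
    (hZ : Z ∈ antiFixed θ) {k : G} (hk : k ∈ K) (heq : (expE X * expE Y : G) = expE Z * k) :
    exp (chartAd (E := E) G X) * exp ((2 : ℝ) • chartAd (E := E) G Y) *
      exp (chartAd (E := E) G X) = exp ((2 : ℝ) • chartAd (E := E) G Z) := by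
  have hθ : θ * θ = 1 := by ext U; exact h.involutive U
  have hm : ∀ a b : G, Ad (E := E) (a * b) = Ad (E := E) a * Ad (E := E) b := Ad_mul
  have hinv : ∀ X : E, Ad (E := E) (expE X : G) * Ad (expE (-X) : G) = 1 := fun X => by
    rw [← hm, expE_neg, mul_inv_cancel, Ad_one]
  have hinv' : ∀ X : E, Ad (E := E) (expE (-X) : G) * Ad (expE X : G) = 1 := fun X => by
    rw [← hm, expE_neg, inv_mul_cancel, Ad_one]
  have h1 : Ad (E := E) (expE X : G) * Ad (expE Y : G) = Ad (expE Z : G) * Ad k := by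
    rw [← hm, heq, hm]
  have hkθ : θ * Ad k * θ = Ad (E := E) k := by
    ext U
    change θ (Ad k (θ U)) = _
    rw [h.Ad_apply k hk, h.involutive]
  have h2 : Ad (E := E) (expE (-X) : G) * Ad (expE (-Y) : G) = Ad (expE (-Z) : G) * Ad k := by
    rw [← h.mul_Ad_expE_mul hX, ← h.mul_Ad_expE_mul hY, ← h.mul_Ad_expE_mul hZ]
    have e : ∀ a b : E →L[ℝ] E, (θ * a * θ) * (θ * b * θ) = θ * (a * b) * θ := fun a b => by
      calc _ = θ * a * (θ * θ) * b * θ := by simp only [mul_assoc]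
        _ = _ := by rw [hθ]; simp only [mul_assoc, one_mul]
    rw [e, h1, ← e, hkθ]
  have h2e : ∀ T : E →L[ℝ] E, exp ((2 : ℝ) • T) = exp T * exp T :=
    exp_two_smul (A := E →L[ℝ] E)
  rw [h2e, h2e, ← Ad_expE, ← Ad_expE, ← Ad_expE]
  set x := Ad (E := E) (expE X : G) with hx
  set y := Ad (E := E) (expE Y : G) with hy
  set z := Ad (E := E) (expE Z : G) with hz
  set κ := Ad (E := E) k with hκ
  have h3 : κ * y * x = z := by
    have h4 : κ = z * (Ad (E := E) (expE (-X) : G) * Ad (E := E) (expE (-Y) : G)) := by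
      rw [h2, ← mul_assoc, hinv, one_mul]
    calc κ * y * x = z * (Ad (E := E) (expE (-X) : G) *
          (Ad (E := E) (expE (-Y) : G) * y) * x) := by
          rw [h4]; simp only [mul_assoc]
      _ = z := by rw [hinv', mul_one, hinv', mul_one]
  calc x * (y * y) * x = (x * y) * y * x := by simp only [mul_assoc]
    _ = z * (κ * y * x) := by rw [h1]; simp only [mul_assoc]
    _ = z * z := by rw [h3]

/-- Invariant inner product on the Lie algebra for which short broken geodesics can be shortened by
cutting corners. -/
theorem IsCompactSymmetric.exists_inner_corner [ConnectedSpace G]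
    (hZ : Finite (Subgroup.center G)) {K : Subgroup G} {θ : E →L[ℝ] E}
    (h : IsCompactSymmetric K θ) :
    ∃ B : E →L[ℝ] E →L[ℝ] ℝ, (∀ k ∈ K, ∀ U V, B (Ad k U) (Ad k V) = B U V) ∧
      (∃ c > 0, ∀ U, c * ‖U‖ ^ 2 ≤ B U U) ∧
      ∃ δ > 0, ∀ X ∈ antiFixed θ, ∀ Y ∈ antiFixed θ, ‖X‖ ≤ δ → ‖Y‖ ≤ δ → X ≠ Y →
        ∃ Z ∈ antiFixed θ, ∃ k ∈ K, (expE X * expE Y : G) = expE Z * k ∧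
          B Z Z < 2 * (B X X + B Y Y) := by
  have : IsTopologicalGroup G := topologicalGroup_of_lieGroup 𝓘(ℝ, E) ∞
  have : CompactSpace K := isCompact_iff_compactSpace.1 h.isCompact
  obtain ⟨B, hB, ⟨c, hc, hBc⟩, hinv⟩ := exists_invariant_inner (H := K)
    (ρ := fun k => Ad (E := E) (k : G)) (continuous_Ad.comp continuous_subtype_val)
    (fun k l => Ad_mul (k : G) l) Ad_one
  have hinv' : ∀ k ∈ K, ∀ U V, B (Ad k U) (Ad k V) = B U V := fun k hk => hinv ⟨k, hk⟩
  obtain ⟨L₀, hL₀⟩ := LinearMap.exists_leftInverse_of_injective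
    (chartAd (E := E) G : E →ₗ[ℝ] E →L[ℝ] E)
    (LinearMap.ker_eq_bot.2 (chartAd_injective hZ))
  let L : (E →L[ℝ] E) →L[ℝ] E := LinearMap.toContinuousLinearMap L₀
  have hL : ∀ U, L (chartAd (E := E) G U) = U := fun U => LinearMap.congr_fun hL₀ U
  let P : E →L[ℝ] E := (1 / 2 : ℝ) • (1 - θ)
  let Q : E →L[ℝ] E := (1 / 2 : ℝ) • (1 + θ)
  have hPQ : P + Q = 1 := by simp only [P, Q]; module
  have hPU : ∀ U, P U = (1 / 2 : ℝ) • (U - θ U) := fun U => rfl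
  have hQU : ∀ U, Q U = (1 / 2 : ℝ) • (U + θ U) := fun U => rfl
  have hP : ∀ U ∈ antiFixed θ, P U = U := fun U hU => by
    rw [hPU, mem_antiFixed.1 hU]; module
  have hPmem : ∀ U, P U ∈ antiFixed θ := fun U => by
    rw [mem_antiFixed, hPU, map_smul, map_sub, h.involutive]; module
  have hQfix : ∀ U, θ (Q U) = Q U := fun U => by
    rw [hQU, map_smul, map_add, h.involutive]; module
  -- For `V ∈ 𝔭` the bracket lies in `𝔨` and `P` kills it. For `V ∈ 𝔨`, `B X [V, X] = 0` because `B`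
  -- is invariant under `exp (tV) ∈ K`.
  have hskew : ∀ X ∈ antiFixed θ, ∀ V, B X (P (chartAd (E := E) G X V)) = 0 := by
    intro X hX V
    have e : V = P V + Q V := by rw [← add_apply, hPQ]; rfl
    have h1 : P (chartAd (E := E) G X (P V)) = 0 := by
      rw [hPU, h.map_chartAd, mem_antiFixed.1 hX, mem_antiFixed.1 (hPmem V)]
      simp
    have h2 : P (chartAd (E := E) G X (Q V)) = chartAd (E := E) G X (Q V) := by
      refine hP _ ?_
      rw [mem_antiFixed, h.map_chartAd, mem_antiFixed.1 hX, hQfix]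
      simp
    have h3 : chartAd (E := E) G X (Q V) = -chartAd (E := E) G (Q V) X :=
      chartAd_swap _ _
    have h4 := inner_chartAd_skew (G := G) (B := B) (W := Q V) (fun t U V' => by
      refine hinv' _ (h.expE_mem _ ?_) U V'
      rw [map_smul, hQfix]) X X
    rw [hB, ← two_mul] at h4
    rw [e, map_add, map_add, h1, zero_add, h2, h3, map_neg]
    linarith
  obtain ⟨δ₁, hδ₁, hcut⟩ := exists_corner_cutting (chartAd_chartAd (E := E) (G := G)) hL hB hc hBc
    hP hskew
  -- For `X, Y` small the product `expE X * expE Y` is near `1`, so it is `expE (P U) * expE (Q U)`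
  -- with `Z = P U` of norm at most `δ₁`.
  have hW : P ⁻¹' closedBall 0 δ₁ ∈ 𝓝 (0 : E) :=
    P.continuous.continuousAt.preimage_mem_nhds (by
      rw [map_zero]; exact closedBall_mem_nhds _ hδ₁)
  have hN := image_expE_mul_expE_mem_nhds (G := G) hPQ hW
  have hcont : Tendsto (fun p : E × E => (expE p.1 * expE p.2 : G)) (𝓝 (0, 0)) (𝓝 1) := by
    have : Continuous fun p : E × E => (expE p.1 * expE p.2 : G) :=
      (continuous_expE.comp continuous_fst).mul (continuous_expE.comp continuous_snd)
    simpa using this.tendsto (0, 0)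
  obtain ⟨δ₂, hδ₂, hball⟩ := Metric.nhds_basis_closedBall.mem_iff.1 (hcont hN)
  refine ⟨B, hinv', ⟨c, hc, hBc⟩, min δ₁ δ₂, lt_min hδ₁ hδ₂, ?_⟩
  intro X hX Y hY hXδ hYδ hne
  obtain ⟨hX1, hX2⟩ := le_min_iff.1 hXδ
  obtain ⟨hY1, hY2⟩ := le_min_iff.1 hYδ
  have hXY : (X, Y) ∈ closedBall ((0 : E), (0 : E)) δ₂ := by
    rw [mem_closedBall, Prod.dist_eq, dist_zero_right, dist_zero_right]
    exact max_le hX2 hY2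
  obtain ⟨U, hU, hUeq⟩ := hball hXY
  simp only at hUeq
  have hk : (expE (Q U) : G) ∈ K := h.expE_mem _ (hQfix U)
  refine ⟨P U, hPmem U, expE (Q U), hk, hUeq.symm, ?_⟩
  exact hcut X hX Y hY (P U) (hPmem U) hX1 hY1 (by simpa using hU)
    (h.exp_eq_of_expE_mul hX hY (hPmem U) hk hUeq.symm) hne

end Symmetric

end LieKP

namespace LieKP

open scoped NNReal
open Filter Topology Set Metric NormedSpace

set_option linter.unusedSectionVars false

/-! ### Broken geodesics and minimisation of the energy. -/

section Minimise

variable {E : Type*} [NormedAddCommGroup E] [NormedSpace ℝ E]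
  [FiniteDimensional ℝ E] [CompleteSpace E]
  {G : Type*} [TopologicalSpace G] [T2Space G] [ChartedSpace E G] [Group G]
  [LieGroup 𝓘(ℝ, E) ∞ G]

/-- The end point of the broken geodesic with sides `l`. -/
noncomputable def expProd (l : List E) : G := (l.map expE).prod

/-- The energy of the broken geodesic with sides `l`. -/
noncomputable def energy (B : E →L[ℝ] E →L[ℝ] ℝ) (l : List E) : ℝ :=
  (l.map fun X => B X X).sum

/-- The broken geodesic with sides `l` runs along the `(-1)`-eigenspace of `θ` and
ends in `g K`. -/
def IsBroken (K : Subgroup G) (θ : E →L[ℝ] E) (g : G) (l : List E) : Prop :=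
  (∀ X ∈ l, X ∈ antiFixed θ) ∧ ∃ k ∈ K, expProd l = g * k

@[simp] theorem expProd_nil : (expProd ([] : List E) : G) = 1 := rfl

@[simp] theorem expProd_cons (X : E) (l : List E) :
    (expProd (X :: l) : G) = expE X * expProd l := by simp [expProd]

@[simp] theorem expProd_append (l l' : List E) :
    (expProd (l ++ l') : G) = expProd l * expProd l' := by simp [expProd]

/-- Moving `k` past a side turns `X` into `Ad k X`; this is how elements of `K` are collected at the
right end. -/
theorem mul_expProd (k : G) (l : List E) :
    k * expProd l = expProd (l.map (Ad k)) * k := by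
  induction l with
  | nil => simp
  | cons X l ih =>
    rw [List.map_cons, expProd_cons, expProd_cons, ← expE_conj, ← mul_assoc]
    simp only [mul_assoc]
    rw [← ih]
    group

theorem expProd_replicate (n : ℕ) (X : E) :
    (expProd (List.replicate n X) : G) = expE ((n : ℝ) • X) := by
  simp [expProd, expE_nsmul]

variable {B : E →L[ℝ] E →L[ℝ] ℝ}

@[simp] theorem energy_nil : energy B [] = 0 := rfl

@[simp] theorem energy_cons (X : E) (l : List E) : energy B (X :: l) = B X X + energy B l := by
  simp [energy]

@[simp] theorem energy_append (l l' : List E) : energy B (l ++ l') = energy B l + energy B l' := by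
  simp [energy]

theorem energy_map {T : E → E} (hT : ∀ U, B (T U) (T U) = B U U) (l : List E) :
    energy B (l.map T) = energy B l := by
  simp [energy, Function.comp_def, hT]

theorem le_energy (hB : ∀ U, 0 ≤ B U U) {l : List E} {X : E} (hX : X ∈ l) :
    B X X ≤ energy B l :=
  List.single_le_sum (by simp +contextual [hB]) _ (List.mem_map_of_mem hX)

/-- A broken geodesic with equal sides, each `n` times shorter. -/
noncomputable def subdivide (n : ℕ) (l : List E) : List E :=
  l.flatMap fun X => List.replicate n ((n : ℝ)⁻¹ • X)

theorem expProd_subdivide {n : ℕ} (hn : n ≠ 0) (l : List E) :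
    (expProd (subdivide n l) : G) = expProd l := by
  induction l with
  | nil => rfl
  | cons X l ih =>
    have : (n : ℝ) ≠ 0 := Nat.cast_ne_zero.2 hn
    simp only [subdivide, List.flatMap_cons, expProd_append, expProd_replicate, expProd_cons,
      smul_smul, mul_inv_cancel₀ this, one_smul] at ih ⊢
    rw [ih]

theorem energy_subdivide {n : ℕ} (hn : n ≠ 0) (l : List E) :
    energy B (subdivide n l) = (n : ℝ)⁻¹ * energy B l := by
  induction l with
  | nil => simp [subdivide]
  | cons X l ih =>
    have hn' : (n : ℝ) ≠ 0 := Nat.cast_ne_zero.2 hn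
    simp only [subdivide, List.flatMap_cons, energy_append, energy_cons, mul_add] at ih ⊢
    rw [ih]
    simp [energy]
    field_simp

namespace IsCompactSymmetric

variable {K : Subgroup G} {θ : E →L[ℝ] E}

theorem exists_isBroken [ConnectedSpace G] (h : IsCompactSymmetric K θ) (g : G) :
    ∃ l, IsBroken K θ g l := by
  have : IsTopologicalGroup G := topologicalGroup_of_lieGroup 𝓘(ℝ, E) ∞
  have hmul : ∀ k ∈ K, ∀ g l, IsBroken K θ g l → ∃ l, IsBroken K θ (k * g) l := by
    rintro k hk g l ⟨hl, k', hk', heq⟩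
    refine ⟨l.map (Ad k), ?_, k' * k⁻¹, K.mul_mem hk' (K.inv_mem hk), ?_⟩
    · intro X hX
      obtain ⟨Y, hY, rfl⟩ := List.mem_map.1 hX
      exact h.Ad_mem hk (hl Y hY)
    · rw [← mul_assoc, mul_assoc k, ← heq, mul_expProd, mul_inv_cancel_right]
  have hexp : ∀ X ∈ antiFixed θ, ∀ g l, IsBroken K θ g l → ∃ l, IsBroken K θ (expE X * g) l := by
    rintro X hX g l ⟨hl, k', hk', heq⟩
    exact ⟨X :: l, by simpa [hX] using hl, k', hk', by rw [expProd_cons, heq, mul_assoc]⟩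
  have htop : Subgroup.closure ((expE '' (antiFixed θ : Set E) : Set G) ∪ K) = ⊤ := by
    refine subgroup_eq_top_of_mem_nhds ?_
    let P : E →L[ℝ] E := (1 / 2 : ℝ) • (1 - θ)
    let Q : E →L[ℝ] E := (1 / 2 : ℝ) • (1 + θ)
    have hPQ : P + Q = 1 := by simp only [P, Q]; module
    have hPU : ∀ U, P U = (1 / 2 : ℝ) • (U - θ U) := fun U => rfl
    have hQU : ∀ U, Q U = (1 / 2 : ℝ) • (U + θ U) := fun U => rfl
    refine mem_of_superset (image_expE_mul_expE_mem_nhds (G := G) hPQ univ_mem) ?_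
    rintro _ ⟨U, -, rfl⟩
    refine Subgroup.mul_mem _ (Subgroup.subset_closure (Or.inl ⟨_, ?_, rfl⟩))
      (Subgroup.subset_closure (Or.inr (h.expE_mem _ ?_)))
    · rw [SetLike.mem_coe, mem_antiFixed, hPU, map_smul, map_sub, h.involutive]; module
    · rw [hQU, map_smul, map_add, h.involutive]; module
  have hg : g ∈ Subgroup.closure ((expE '' (antiFixed θ : Set E) : Set G) ∪ K) :=
    htop ▸ Subgroup.mem_top g
  induction hg using Subgroup.closure_induction_left with
  | one => exact ⟨[], by simp, 1, K.one_mem, by simp⟩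
  | mul_left x hx y hy ih =>
    obtain ⟨l, hl⟩ := ih
    obtain ⟨X, hX, rfl⟩ | hx := hx
    · exact hexp X hX y l hl
    · exact hmul x hx y l hl
  | inv_mul_cancel x hx y hy ih =>
    obtain ⟨l, hl⟩ := ih
    obtain ⟨X, hX, rfl⟩ | hx := hx
    · rw [← expE_neg]
      exact hexp (-X) ((antiFixed θ).neg_mem hX) y l hl
    · exact hmul _ (K.inv_mem hx) y l hl

/-- Among the broken geodesics with a given number of sides there is one of least energy. -/
theorem exists_minimal (h : IsCompactSymmetric K θ) {c : ℝ} (hc : 0 < c)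
    (hB : ∀ U, c * ‖U‖ ^ 2 ≤ B U U) {g : G} {l₀ : List E} (hl₀ : IsBroken K θ g l₀) :
    ∃ l, IsBroken K θ g l ∧ l.length = l₀.length ∧
      ∀ l', IsBroken K θ g l' → l'.length = l₀.length → energy B l ≤ energy B l' := by
  have : IsTopologicalGroup G := topologicalGroup_of_lieGroup 𝓘(ℝ, E) ∞
  set n := l₀.length with hn
  let S : Set (Fin n → E) := {x | IsBroken K θ g (List.ofFn x)}
  let f : (Fin n → E) → ℝ := fun x => ∑ i, B (x i) (x i)
  have hf : ∀ x, energy B (List.ofFn x) = f x := fun x => by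
    simp [energy, f, List.map_ofFn, List.sum_ofFn]
  have hfc : Continuous f := continuous_finsetSum _ fun i _ =>
    ((B.continuous.comp (continuous_apply i)).clm_apply (continuous_apply i))
  have hprod : Continuous fun x : Fin n → E => (expProd (List.ofFn x) : G) := by
    simp only [expProd, List.map_ofFn]
    simp only [List.ofFn_eq_map]
    exact continuous_list_prod _ fun i _ => continuous_expE.comp (continuous_apply i)
  have hS : IsClosed S := by
    have e : S = (⋂ i, (fun x : Fin n → E => x i) ⁻¹' (antiFixed θ : Set E)) ∩
        (fun x : Fin n → E => g⁻¹ * (expProd (List.ofFn x) : G)) ⁻¹' (K : Set G) := by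
      ext x
      simp only [S, IsBroken, mem_ofPred_eq, mem_inter_iff, mem_iInter, mem_preimage,
        SetLike.mem_coe, List.mem_ofFn, forall_exists_index, forall_apply_eq_imp_iff]
      refine and_congr Iff.rfl ⟨?_, fun hx => ⟨_, hx, by simp⟩⟩
      rintro ⟨k, hk, e⟩
      rw [e, inv_mul_cancel_left]
      exact hk
    rw [e]
    refine (isClosed_iInter fun i => ?_).inter ?_
    · exact (antiFixed θ).closed_of_finiteDimensional.preimage (continuous_apply i)
    · exact h.isCompact.isClosed.preimage (continuous_const.mul hprod)
  have hB0 : ∀ U, 0 ≤ B U U := fun U => le_trans (by positivity) (hB U)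
  let x₀ : Fin n → E := l₀.get
  have hx₀ : x₀ ∈ S := by simpa [S, x₀] using hl₀
  -- The admissible tuples form a closed set, as `K` is compact, and coercivity of `B` bounds the
  -- sublevel set of the energy.
  have hcpt : IsCompact (S ∩ {x | f x ≤ f x₀}) := by
    refine Metric.isCompact_of_isClosed_isBounded
      (hS.inter (isClosed_le hfc continuous_const)) ?_
    refine (Metric.isBounded_closedBall (x := (0 : Fin n → E)) (r := √(f x₀ / c))).subset ?_
    rintro x ⟨-, hx⟩
    rw [mem_closedBall, dist_zero_right, pi_norm_le_iff_of_nonneg (Real.sqrt_nonneg _)]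
    intro i
    refine Real.le_sqrt_of_sq_le ?_
    rw [le_div_iff₀ hc, mul_comm]
    refine (hB _).trans (le_trans ?_ hx)
    exact Finset.single_le_sum (f := fun i => B (x i) (x i)) (fun i _ => hB0 _) (Finset.mem_univ i)
  obtain ⟨x, ⟨hxS, hx⟩, hmin⟩ := hcpt.exists_isMinOn ⟨x₀, hx₀, le_refl (f x₀)⟩ hfc.continuousOn
  refine ⟨List.ofFn x, hxS, List.length_ofFn, fun l' hl' hlen => ?_⟩
  obtain ⟨y, rfl⟩ : ∃ y : Fin n → E, List.ofFn y = l' := by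
    rw [← hlen]
    exact ⟨l'.get, List.ofFn_get l'⟩
  rw [hf, hf]
  obtain hy | hy := le_total (f y) (f x₀)
  · exact hmin (show y ∈ _ from ⟨hl', hy⟩)
  · exact le_trans hx hy

/-- The Cartan decomposition `G = exp 𝔭 · K`. -/
theorem exists_eq_expE_mul [ConnectedSpace G] (hZ : Finite (Subgroup.center G))
    (h : IsCompactSymmetric K θ) (g : G) :
    ∃ X ∈ antiFixed θ, ∃ k ∈ K, g = expE X * k := by
  obtain ⟨B, hinv, ⟨c, hc, hBc⟩, δ, hδ, hcut⟩ := h.exists_inner_corner hZ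
  have hB0 : ∀ U, 0 ≤ B U U := fun U => le_trans (by positivity) (hBc U)
  obtain ⟨l₁, hl₁⟩ := h.exists_isBroken g
  -- After subdivision into `n` pieces the energy is at most `c δ²`; the same then holds for the
  -- minimiser, so each of its sides has norm at most `δ`.
  obtain ⟨n, hn⟩ := exists_nat_gt (energy B l₁ / (c * δ ^ 2))
  have hE0 : 0 ≤ energy B l₁ := List.sum_nonneg (by simp +contextual [hB0])
  have hn0 : (0 : ℝ) < n := lt_of_le_of_lt (by positivity) hn
  have hn1 : n ≠ 0 := by exact_mod_cast hn0.ne'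
  have hl₀ : IsBroken K θ g (subdivide n l₁) := by
    refine ⟨fun X hX => ?_, by rw [expProd_subdivide hn1]; exact hl₁.2⟩
    obtain ⟨Y, hY, hX⟩ := List.mem_flatMap.1 hX
    rw [List.eq_of_mem_replicate hX]
    exact (antiFixed θ).smul_mem _ (hl₁.1 Y hY)
  have hE : energy B (subdivide n l₁) ≤ c * δ ^ 2 := by
    rw [energy_subdivide hn1, inv_mul_le_iff₀ hn0]
    exact ((div_lt_iff₀ (by positivity)).1 hn).le
  obtain ⟨l, hl, hlen, hmin⟩ := h.exists_minimal hc hBc hl₀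
  have hsmall : ∀ X ∈ l, ‖X‖ ≤ δ := fun X hX => by
    have h1 : c * ‖X‖ ^ 2 ≤ c * δ ^ 2 :=
      (hBc X).trans ((le_energy hB0 hX).trans ((hmin _ hl₀ rfl).trans hE))
    exact (pow_le_pow_iff_left₀ (norm_nonneg _) hδ.le two_ne_zero).1 (le_of_mul_le_mul_left h1 hc)
  have hchain : List.IsChain (· = ·) l := by
    rw [List.isChain_iff_forall_rel_of_append_cons_cons]
    intro X Y l₂ l₃ heq
    by_contra hne
    have hX : X ∈ l := by simp [heq]
    have hY : Y ∈ l := by simp [heq]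
    obtain ⟨Z, hZ𝔭, k, hk, hXY, hlt⟩ := hcut X (hl.1 X hX) Y (hl.1 Y hY) (hsmall X hX)
      (hsmall Y hY) hne
    set W := (1 / 2 : ℝ) • Z with hW
    have hWW : (expE W * expE W : G) = expE Z := by
      have := expE_add_smul (G := G) Z (1 / 2) (1 / 2)
      rw [← this]
      norm_num
    obtain ⟨k', hk', hg⟩ := hl.2
    -- The competitor has the same number of sides: `X, Y` become `Z/2, Z/2`, of energy `B Z Z / 2 <
    -- B X X + B Y Y`, and the later sides are turned by `Ad k` at no cost.
    have hlt2 := hmin (l₂ ++ W :: W :: l₃.map (Ad k)) ⟨?_, k' * k⁻¹,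
      K.mul_mem hk' (K.inv_mem hk), ?_⟩ ?_
    · rw [heq] at hlt2
      simp only [energy_append, energy_cons, energy_map (fun U => hinv k hk U U)] at hlt2
      simp only [hW, map_smul, smul_apply, smul_eq_mul] at hlt2
      linarith
    · intro U hU
      simp only [List.mem_append, List.mem_cons, List.mem_map] at hU
      have hW𝔭 : W ∈ antiFixed θ := (antiFixed θ).smul_mem _ hZ𝔭
      obtain hU | rfl | rfl | ⟨V, hV, rfl⟩ := hU
      · exact hl.1 U (by simp [heq, hU])
      · exact hW𝔭
      · exact hW𝔭
      · exact h.Ad_mem hk (hl.1 V (by simp [heq, hV]))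
    · rw [← mul_assoc, ← hg, heq]
      simp only [expProd_append, expProd_cons]
      rw [eq_mul_inv_iff_mul_eq]
      calc _ = expProd l₂ * ((expE W * expE W) * (expProd (l₃.map (Ad k)) * k)) := by
            simp only [mul_assoc]
        _ = expProd l₂ * ((expE Z * k) * expProd l₃) := by
            rw [hWW, ← mul_expProd, mul_assoc (expE Z)]
        _ = _ := by rw [← hXY]; simp only [mul_assoc]
    · rw [← hlen, heq]; simp
  obtain ⟨k, hk, hg⟩ := hl.2
  cases l with
  | nil =>
    exact ⟨0, (antiFixed θ).zero_mem, k⁻¹, K.inv_mem hk, by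
      rw [expE_zero, one_mul, eq_inv_iff_mul_eq_one, ← hg, expProd_nil]⟩
  | cons Y l' =>
    have hrep := List.isChain_eq_iff_eq_replicate.1 hchain Y (by simp)
    rw [hrep, expProd_replicate] at hg
    refine ⟨((Y :: l').length : ℝ) • Y, (antiFixed θ).smul_mem _ (hl.1 Y (by simp)), k⁻¹, K.inv_mem hk, ?_⟩
    rw [hg, mul_inv_cancel_right]

end IsCompactSymmetric

end Minimise

end LieKP

/-! ### Conclusion. -/

theorem mainTheorem2
    {E : Type*} [NormedAddCommGroup E] [NormedSpace ℝ E] [FiniteDimensional ℝ E] [CompleteSpace E]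
    {G : Type*} [TopologicalSpace G] [T2Space G] [ChartedSpace E G] [Group G]
    [LieGroup 𝓘(ℝ, E) ∞ G]
    (hcentre : Finite (Subgroup.center G))
    (hG : ConnectedSpace G)
    (K : Subgroup G)
    (hKcompact : IsCompact (K : Set G))
    (hKconnected : IsConnected (K : Set G))
    (θ : GroupLieAlgebra 𝓘(ℝ, E) G ≃ₗ⁅ℝ⁆ GroupLieAlgebra 𝓘(ℝ, E) G)
    (hθ : ∀ X, θ (θ X) = X)
    (hk : LieKP.subgroupLieAlgebra K = LieKP.fixedPart θ) :
    (K : Set G) * (LieKP.lieExp '' LieKP.antiFixedPart θ) = Set.univ := by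
  have : IsTopologicalGroup G := topologicalGroup_of_lieGroup 𝓘(ℝ, E) ∞
  let θ₀ : E →ₗ[ℝ] E :=
    { toFun := fun X => θ X
      map_add' := fun X Y => map_add θ X Y
      map_smul' := fun a X => map_smul θ a X }
  let Θ : E →L[ℝ] E := LinearMap.toContinuousLinearMap θ₀
  -- The part of `K` whose adjoint action commutes with `θ`. It is closed in `K`, hence compact, and
  -- it still contains `exp 𝔨`, since `ad X` commutes with `θ` when `θ X = X`.
  let K' : Subgroup G :=
    { carrier := {k | k ∈ K ∧ ∀ U, LieKP.Ad (E := E) k (Θ U) = Θ (LieKP.Ad (E := E) k U)}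
      one_mem' := ⟨K.one_mem, fun U => by simp⟩
      mul_mem' := by
        rintro a b ⟨ha, ha'⟩ ⟨hb, hb'⟩
        refine ⟨K.mul_mem ha hb, fun U => ?_⟩
        rw [LieKP.Ad_mul, ContinuousLinearMap.comp_apply, ContinuousLinearMap.comp_apply, hb', ha']
      inv_mem' := by
        rintro a ⟨ha, ha'⟩
        refine ⟨K.inv_mem ha, fun U => ?_⟩
        have hl : ∀ V, LieKP.Ad (E := E) a⁻¹ (LieKP.Ad (E := E) a V) = V := fun V => by
          rw [← ContinuousLinearMap.comp_apply, ← LieKP.Ad_mul, inv_mul_cancel, LieKP.Ad_one]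
          rfl
        have hr : ∀ V, LieKP.Ad (E := E) a (LieKP.Ad (E := E) a⁻¹ V) = V := fun V => by
          rw [← ContinuousLinearMap.comp_apply, ← LieKP.Ad_mul, mul_inv_cancel, LieKP.Ad_one]
          rfl
        rw [← hl (Θ (LieKP.Ad (E := E) a⁻¹ U)), ha', hr] }
  have hmap : ∀ X Y : E, Θ (LieKP.chartAd (E := E) G X Y) =
      LieKP.chartAd (E := E) G (Θ X) (Θ Y) := fun X Y =>
    (congrArg θ (LieKP.lie_eq_chartAd (E := E) (G := G) X Y).symm).trans
      ((LieEquiv.map_lie θ _ _).trans (LieKP.lie_eq_chartAd (E := E) (G := G) (θ X) (θ Y)))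
  have hK' : LieKP.IsCompactSymmetric K' Θ :=
    { isCompact := by
        have hcl : IsClosed {k : G | ∀ U, LieKP.Ad (E := E) k (Θ U) = Θ (LieKP.Ad (E := E) k U)} := by
          simp only [Set.ofPred_forall]
          exact isClosed_iInter fun U => isClosed_eq
            (LieKP.continuous_Ad.clm_apply continuous_const)
            (Θ.continuous.comp (LieKP.continuous_Ad.clm_apply continuous_const))
        exact hKcompact.inter_right hcl
      involutive := hθ
      map_chartAd := hmap
      Ad_apply := fun k hk => hk.2
      expE_mem := fun X hX => by
        refine ⟨?_, fun U => ?_⟩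
        · have h1 : ∀ X : GroupLieAlgebra 𝓘(ℝ, E) G, X ∈ LieKP.subgroupLieAlgebra K →
              LieKP.lieExp X ∈ K := fun X h => by simpa using h 1
          exact h1 X (hk ▸ hX)
        · have hc : Commute Θ (LieKP.chartAd (E := E) G X) := by
            ext V
            change Θ (LieKP.chartAd (E := E) G X V) = LieKP.chartAd (E := E) G X (Θ V)
            rw [hmap, hX]
          rw [LieKP.Ad_expE]
          exact congrArg (fun T : E →L[ℝ] E => T U) hc.exp_right.symm }
  refine Set.eq_univ_of_forall fun g => ?_
  -- Decomposing `g⁻¹ = exp X · k` and inverting puts the compact factor on the left: `g = k⁻¹ exp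
  -- (-X)`.
  obtain ⟨X, hX, k, hk', hg⟩ := hK'.exists_eq_expE_mul hcentre g⁻¹
  refine ⟨k⁻¹, K.inv_mem hk'.1, LieKP.expE (-X), ⟨-X, ?_, rfl⟩, ?_⟩
  · exact LieKP.mem_antiFixed.1 ((LieKP.antiFixed Θ).neg_mem hX)
  · change k⁻¹ * LieKP.expE (-X) = g
    rw [LieKP.expE_neg, ← mul_inv_rev, ← hg, inv_inv]
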